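/- **Setting.** Let $U\subseteq\mathbb C^2$ be open with coordinates $(x,y)$, and let $r\ge 2$, $p\ge 1$, $q\ge 0$ be integers. Put $p_1=p-1$, $p_2=p$, let $$\mathcal S^r_{n,q}=\operatorname{span}_{\mathbb C}\{x^iy^j : i,j\ge 0,\ i+rj\le n,\ j\le q\},$$ and let $\mathbf S=\mathcal S^r_{p-1,q}\oplus\mathcal S^r_{p,q}$, regarded as a space of pairs of functions on $U$. Let $\mathfrak D$ be the associative algebra of $2\times2$ matrix differential operators $T=(T_{ab})$, $T_{ab}=\sum f_{st}(x,y)\partial_x^s\partial_y^t$ (finite sums), with complex-smooth (holomorphic) coefficients on $U$; let $\mathfrak S\subseteq\mathfrak D$ be the operators preserving $\mathbf S$ and $\ker\pi\subseteq\mathfrak S$ those annihilating $\mathbf S$. The distinguished complement $\tilde{\mathfrak S}$ of $\ker\pi$ in $\mathfrak S$ consists of the $T\in\mathfrak S$ such that each $T_{ab}$ involves only derivatives $\partial_x^s\partial_y^t$ with $s+rt\le p_b$ and $t\le q$. An operator has nonpositive $y$-degree if each of its entries maps every monomial $x^iy^j$ to a linear combination of monomials $x^{i'}y^{j'}$ with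 $j'\le j$. For $c\in\mathbb C$ let $J^1=\partial_x$, $J^2_c=x^2\partial_x+rxy\partial_y-cx$, $J^3_c=x\partial_x-\tfrac c2$, $J^4=y\partial_y$, and $J^{5+i}=x^i\partial_y$ for $0\le i\le r$. Let $\sigma^+=\begin{pmatrix}0&1\\0&0\end{pmatrix}$ and $\sigma^-=\begin{pmatrix}0&0\\1&0\end{pmatrix}$. The Lie superalgebra $\mathfrak s^r_p$ is spanned by the $10+2r$ generators $$T^i=\operatorname{diag}(J^i_{p-1},J^i_p)\ (1\le i\le 5+r),\qquad J=\tfrac12\operatorname{diag}(p+1,p),$$ $$Q^-_0=\sigma^-,\quad Q^-_1=x\,\sigma^-,\quad Q^+_0=(x\partial_x+ry\partial_y-p)\,\sigma^+,\quad Q^+_1=\partial_x\,\sigma^+,\quad Q^+_{2+\alpha}=x^\alpha\partial_y\,\sigma^+\ (0\le\alpha\le r-1).$$ A polynomial of degree at most $d$ in the generators is a complex linear combination of products of at most $d$ generators, in any order, the empty product being the identity. **Theorem.** Let $T\in\tilde{\mathfrak S}$ have nonpositive $y$-degree and order at most $k$, where $k\ge 0$. 1. If $k\le q$ and $rk\le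 p-1$, then $T$ is a polynomial of degree at most $k+1$ in the generators of $\mathfrak s^r_p$. (The condition $rk\le p-1$ follows from $k\le q$ when $rq\le p-1$, that is, when monomials with $y$-exponent $q$ do occur in both summands of $\mathbf S$.) 2. In every case, in particular if $k>q$, there is a polynomial $P$ of degree at most $k+1$ in the generators of $\mathfrak s^r_p$ such that $P\in\mathfrak S$ and $T$ is the projection of $P$ onto $\tilde{\mathfrak S}$ along $\ker\pi$, i.e. $P-T\in\ker\pi$. -/

import Mathlib

open scoped ContDiff

noncomputable section

namespace Staircase

open TopologicalSpace

/-- The space `C^∞(U, ℂ)` of complex-smooth (that is, holomorphic) functions of the two complex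
variables `x = z.1`, `y = z.2` on the open set `U`. A function on `U` is represented by its
extension by zero, so that two elements are equal exactly when they agree on `U`. -/
def SmoothFn (U : Opens (ℂ × ℂ)) : Submodule ℂ (ℂ × ℂ → ℂ) where
  carrier := {f | ContDiffOn ℂ ∞ f U ∧ ∀ z, z ∉ U → f z = 0}
  add_mem' := by
    rintro f g ⟨hf, hf'⟩ ⟨hg, hg'⟩
    exact ⟨hf.add hg, fun z hz => by simp [hf' z hz, hg' z hz]⟩
  zero_mem' := ⟨contDiffOn_const, fun _ _ => rfl⟩
  smul_mem' := by
    rintro c f ⟨hf, hf'⟩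
    exact ⟨hf.const_smul c, fun z hz => by simp [hf' z hz]⟩

variable {U : Opens (ℂ × ℂ)}

/-- The restriction to `U` of a function that is smooth on `U`. -/
def restrict (F : ℂ × ℂ → ℂ) (hF : ContDiffOn ℂ ∞ F U) : SmoothFn U :=
  ⟨(U : Set (ℂ × ℂ)).indicator F,
    hF.congr fun _ hz => Set.indicator_of_mem hz F,
    fun _ hz => Set.indicator_of_notMem hz F⟩

/-- The monomial function `x ^ i * y ^ j` on `U`. -/
def mono (U : Opens (ℂ × ℂ)) (i j : ℕ) : SmoothFn U :=
  restrict (fun z => z.1 ^ i * z.2 ^ j)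
    ((contDiff_fst.pow i).mul (contDiff_snd.pow j)).contDiffOn

/-- The `ℂ`-linear operators on `C^∞(U, ℂ)`, an associative algebra under composition. -/
abbrev Op (U : Opens (ℂ × ℂ)) : Type := Module.End ℂ (SmoothFn U)

/-- The operator of multiplication by a smooth function. -/
def mulOp (f : SmoothFn U) : Op U where
  toFun g := ⟨fun z => f.1 z * g.1 z, f.2.1.mul g.2.1, fun z hz => by simp [f.2.2 z hz]⟩
  map_add' g h := by
    ext z
    exact mul_add _ _ _
  map_smul' c g := by
    ext z
    exact mul_left_comm _ _ _

theorem contDiffOn_fderiv_apply (v : ℂ × ℂ) (f : SmoothFn U) :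
    ContDiffOn ℂ ∞ (fun z => fderiv ℂ f.1 z v) U :=
  ((contDiffOn_infty_iff_fderiv_of_isOpen U.isOpen).1 f.2.1).2.clm_apply contDiffOn_const

theorem differentiableAt_of_mem (f : SmoothFn U) {z : ℂ × ℂ} (hz : z ∈ U) :
    DifferentiableAt ℂ f.1 z :=
  (f.2.1.differentiableOn (by simp)).differentiableAt (U.isOpen.mem_nhds hz)

/-- Differentiation in the direction `v`. -/
def derivOp (v : ℂ × ℂ) : Op U where
  toFun f := restrict (fun z => fderiv ℂ f.1 z v) (contDiffOn_fderiv_apply v f)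
  map_add' f g := by
    ext z
    by_cases hz : z ∈ (U : Set (ℂ × ℂ))
    · have h := fderiv_add (differentiableAt_of_mem f hz) (differentiableAt_of_mem g hz)
      simp [restrict, hz, h]
    · simp [restrict, hz]
  map_smul' c f := by
    ext z
    by_cases hz : z ∈ (U : Set (ℂ × ℂ))
    · have h := fderiv_const_smul (differentiableAt_of_mem f hz) c
      simp [restrict, hz, h]
    · simp [restrict, hz]

/-- The operator `∂/∂x`. -/
def dx : Op U := derivOp (1, 0)

/-- The operator `∂/∂y`. -/
def dy : Op U := derivOp (0, 1)

/-- Multiplication by the coordinate `x`. -/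
def X : Op U := mulOp (mono U 1 0)

/-- Multiplication by the coordinate `y`. -/
def Y : Op U := mulOp (mono U 0 1)

/-- The scalar differential operators `∑ f_{st} ∂_x^s ∂_y^t` (finite sums, smooth coefficients)
in which only index pairs `(s, t) ∈ I` occur. -/
def diffOps (U : Opens (ℂ × ℂ)) (I : Set (ℕ × ℕ)) : Submodule ℂ (Op U) :=
  Submodule.span ℂ {D | ∃ (f : SmoothFn U) (s t : ℕ), (s, t) ∈ I ∧ D = mulOp f * dx ^ s * dy ^ t}

/-- The index set (lattice of exponents) `{(i, j) | i + r j ≤ p, j ≤ q}`. -/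
def stairs (r p q : ℕ) : Set (ℕ × ℕ) := {m | m.1 + r * m.2 ≤ p ∧ m.2 ≤ q}

/-- The scalar staircase module spanned by the monomials `x^i y^j`, `i + r j ≤ p`, `j ≤ q`. -/
def scalarModule (U : Opens (ℂ × ℂ)) (r p q : ℕ) : Submodule ℂ (SmoothFn U) :=
  Submodule.span ℂ {g | ∃ i j : ℕ, (i, j) ∈ stairs r p q ∧ g = mono U i j}

/-- `2 × 2` matrices of operators. -/
abbrev MatOp (U : Opens (ℂ × ℂ)) : Type := Matrix (Fin 2) (Fin 2) (Op U)

/-- The action of a matrix of operators on a pair of functions. -/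
def act (T : MatOp U) (v : Fin 2 → SmoothFn U) : Fin 2 → SmoothFn U :=
  fun a => ∑ b, T a b (v b)

/-- The associative algebra of `2 × 2` matrix differential operators. -/
def matDiffOps (U : Opens (ℂ × ℂ)) : Set (MatOp U) :=
  {T | ∀ a b, T a b ∈ diffOps U Set.univ}

/-- The parameter `p_j` of the two summands: `p - 1` for the first, `p` for the second. -/
def width (p : ℕ) : Fin 2 → ℕ := ![p - 1, p]

/-- The direct sum of the staircase modules with parameters `(p - 1, q)` and `(p, q)`. -/
def stairModule (U : Opens (ℂ × ℂ)) (r p q : ℕ) : Set (Fin 2 → SmoothFn U) :=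
  {v | ∀ b, v b ∈ scalarModule U r (width p b) q}

/-- The matrix differential operators that preserve the direct sum module. -/
def preserving (U : Opens (ℂ × ℂ)) (r p q : ℕ) : Set (MatOp U) :=
  {T | T ∈ matDiffOps U ∧ ∀ v ∈ stairModule U r p q, act T v ∈ stairModule U r p q}

/-- The kernel of the restriction map from the module-preserving operators to the endomorphisms
of the module. -/
def kernel (U : Opens (ℂ × ℂ)) (r p q : ℕ) : Set (MatOp U) :=
  {T | T ∈ preserving U r p q ∧ ∀ v ∈ stairModule U r p q, act T v = 0}

/-- The distinguished complement to the kernel: the module-preserving operators whose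
entry `T_{ab}` involves only the derivatives `∂_x^s ∂_y^t` with `s + r t ≤ p_b`, `t ≤ q`. -/
def complement (U : Opens (ℂ × ℂ)) (r p q : ℕ) : Set (MatOp U) :=
  {T | T ∈ preserving U r p q ∧ ∀ a b, T a b ∈ diffOps U (stairs r (width p b) q)}

/-- The operator has nonpositive `y`-degree: each entry maps every monomial `x^i y^j`
to a polynomial all of whose monomials `x^{i'} y^{j'}` have `j' ≤ j`. -/
def YDegNonpos (T : MatOp U) : Prop :=
  ∀ a b, ∀ i j : ℕ,
    T a b (mono U i j) ∈ Submodule.span ℂ {g | ∃ i' j' : ℕ, j' ≤ j ∧ g = mono U i' j'}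

/-- The part of the distinguished complement of nonpositive `y`-degree. -/
def complementDown (U : Opens (ℂ × ℂ)) (r p q : ℕ) : Set (MatOp U) :=
  {T | T ∈ complement U r p q ∧ YDegNonpos T}

/-- The matrix differential operators of order at most `k`. -/
def orderLE (U : Opens (ℂ × ℂ)) (k : ℕ) : Set (MatOp U) :=
  {T | ∀ a b, T a b ∈ diffOps U {m | m.1 + m.2 ≤ k}}

/-- `P` is a module-preserving operator whose projection onto the distinguished complement,
along the kernel, is `T`. -/
def IsProjection (r p q : ℕ) (P T : MatOp U) : Prop :=
  P ∈ preserving U r p q ∧ T ∈ complement U r p q ∧ P - T ∈ kernel U r p q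

/-! ### The generators -/

/-- `x² ∂_x + r x y ∂_y - c x`. -/
def J2 (r : ℕ) (c : ℂ) : Op U := X ^ 2 * dx + (r : ℂ) • (X * Y * dy) - c • X

/-- `x ∂_x - c / 2`. -/
def J3 (c : ℂ) : Op U := X * dx - (c / 2) • 1

/-- Labels of the `10 + 2 r` generators of the Lie superalgebra:
`T^1, …, T^4`, `T^{5+i}` for `0 ≤ i ≤ r`, `J`, `Q^-_0`, `Q^-_1`, `Q^+_0`, `Q^+_1`, and
`Q^+_{2+α}` for `0 ≤ α ≤ r - 1`. -/
inductive Gen (r : ℕ) : Type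
  | T1 | T2 | T3 | T4
  | T5 (i : Fin (r + 1))
  | J
  | Qm0 | Qm1 | Qp0 | Qp1
  | Qp2 (α : Fin r)

/-- The generators as matrix differential operators. -/
def gen (U : Opens (ℂ × ℂ)) (r p : ℕ) : Gen r → MatOp U
  | .T1 => !![dx, 0; 0, dx]
  | .T2 => !![J2 r ((p : ℂ) - 1), 0; 0, J2 r (p : ℂ)]
  | .T3 => !![J3 ((p : ℂ) - 1), 0; 0, J3 (p : ℂ)]
  | .T4 => !![Y * dy, 0; 0, Y * dy]
  | .T5 i => !![X ^ (i : ℕ) * dy, 0; 0, X ^ (i : ℕ) * dy]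
  | .J => !![(((p : ℂ) + 1) / 2) • 1, 0; 0, ((p : ℂ) / 2) • 1]
  | .Qm0 => !![0, 0; 1, 0]
  | .Qm1 => !![0, 0; X, 0]
  | .Qp0 => !![0, X * dx + (r : ℂ) • (Y * dy) - (p : ℂ) • 1; 0, 0]
  | .Qp1 => !![0, dx; 0, 0]
  | .Qp2 α => !![0, X ^ (α : ℕ) * dy; 0, 0]

/-- The operators that are (noncommutative) polynomials of degree at most `d` in the generators:
linear combinations of products of at most `d` generators, the empty product being `1`. -/
def polysLE (U : Opens (ℂ × ℂ)) (r p d : ℕ) : Submodule ℂ (MatOp U) :=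
  Submodule.span ℂ {P | ∃ l : List (Gen r), l.length ≤ d ∧ P = (l.map (gen U r p)).prod}

end Staircase

end

noncomputable section

namespace Staircase

open TopologicalSpace

variable {U : Opens (ℂ × ℂ)}

/-! ### Smooth functions and the Weyl relations -/

/-! An entry of `T` maps a staircase of width `P` to one of width `P'`, where `P' - P` is 0 or ±1.
Since the y-degree is nonpositive, its coefficients are polynomials, so it is a combination of
normally ordered monomials `x^a y^b ∂x^s ∂y^t` with `b ≤ t`. Weight `x` by 1 and `y` by `r`. Terms
of weight at most `P' - P` map one staircase to the other, and peeling off first-order factors from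
the left writes them in the generators (`IsGenFiltration.weylMono_mem`).

The remaining terms push monomials towards the slanted edge `i + r j = P`. They are expanded in the
Newton basis `newtonOp`, which acts on `x^i y^j` by `u^{(a)} j^{(b+d)} x^{m+rd+i} y^{j-d}`, where `u
= P - i - r j` is the distance to that edge. If `m ≤ a + P' - P`, the falling factorial vanishes
wherever the shift would leave the target, and the operator is again a product of generators,
because `x^e V^{(e)} = (-J2)^e` with `V` the coweight (`X_pow_mul_falling`). If `m > a + P' - P`,
there are two cases. When the source has a monomial with `u = a` and `j = b + d`, the coefficient is
zero, by a triangular argument (`newton_coeff_eq_zero`). Otherwise the operator annihilates the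
source and goes into the kernel part. When `k ≤ q` and `r k ≤ P` the second case does not occur, so
the kernel part is zero.

The extra 1 in the degree `k + 1` pays for selecting a matrix entry: `J` and the identity span the
diagonal idempotents, and `Q^-` gives the lower entry. In the upper entry `Q^+` is itself of first
order and serves as one of the factors. -/

theorem SmoothFn.ext_on {f g : SmoothFn U} (h : ∀ z ∈ U, f.1 z = g.1 z) : f = g := by
  ext z
  by_cases hz : z ∈ U
  · exact h z hz
  · rw [f.2.2 z hz, g.2.2 z hz]

theorem mulOp_apply (f g : SmoothFn U) (z : ℂ × ℂ) : (mulOp f g).1 z = f.1 z * g.1 z := rfl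

theorem derivOp_apply (v : ℂ × ℂ) (f : SmoothFn U) {z : ℂ × ℂ} (hz : z ∈ U) :
    (derivOp v f).1 z = fderiv ℂ f.1 z v :=
  Set.indicator_of_mem (s := (U : Set (ℂ × ℂ))) hz fun z => fderiv ℂ f.1 z v

theorem mono_apply (i j : ℕ) {z : ℂ × ℂ} (hz : z ∈ U) : (mono U i j).1 z = z.1 ^ i * z.2 ^ j :=
  Set.indicator_of_mem (s := (U : Set (ℂ × ℂ))) hz fun z => z.1 ^ i * z.2 ^ j

theorem derivOp_mono_apply (v : ℂ × ℂ) (i j : ℕ) {z : ℂ × ℂ} (hz : z ∈ U) :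
    (derivOp v (mono U i j)).1 z =
      z.1 ^ i * (j * z.2 ^ (j - 1) * v.2) + z.2 ^ j * (i * z.1 ^ (i - 1) * v.1) := by
  rw [derivOp_apply _ _ hz]
  have h : (mono U i j).1 =ᶠ[nhds z] fun z => z.1 ^ i * z.2 ^ j := by
    filter_upwards [U.isOpen.mem_nhds hz] with w hw using mono_apply i j hw
  have h1 : HasFDerivAt (fun z : ℂ × ℂ => z.1 ^ i) _ z :=
    (hasFDerivAt_fst (𝕜 := ℂ) (p := z)).pow i
  have h2 : HasFDerivAt (fun z : ℂ × ℂ => z.2 ^ j) _ z :=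
    (hasFDerivAt_snd (𝕜 := ℂ) (p := z)).pow j
  have h3 := congrArg (fun L => L v) (h1.mul h2).fderiv
  rw [h.fderiv_eq]
  exact h3.trans (by simp)

theorem dx_mono (i j : ℕ) : dx (mono U i j) = (i : ℂ) • mono U (i - 1) j := by
  refine SmoothFn.ext_on fun z hz => ?_
  rw [dx, derivOp_mono_apply _ _ _ hz]
  change _ = (i : ℂ) * (mono U (i - 1) j).1 z
  rw [mono_apply _ _ hz]
  ring

theorem dy_mono (i j : ℕ) : dy (mono U i j) = (j : ℂ) • mono U i (j - 1) := by
  refine SmoothFn.ext_on fun z hz => ?_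
  rw [dy, derivOp_mono_apply _ _ _ hz]
  change _ = (j : ℂ) * (mono U i (j - 1)).1 z
  rw [mono_apply _ _ hz]
  ring

theorem mulOp_mono_mono (a b i j : ℕ) :
    mulOp (mono U a b) (mono U i j) = mono U (a + i) (b + j) := by
  refine SmoothFn.ext_on fun z hz => ?_
  rw [mulOp_apply, mono_apply _ _ hz, mono_apply _ _ hz, mono_apply _ _ hz]
  ring

theorem mulOp_mulOp (f g : SmoothFn U) : mulOp f * mulOp g = mulOp (mulOp f g) := by
  refine LinearMap.ext fun h => Subtype.ext (funext fun z => ?_)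
  exact (mul_assoc _ _ _).symm

theorem mulOp_comm (f g : SmoothFn U) : mulOp f * mulOp g = mulOp g * mulOp f := by
  refine LinearMap.ext fun h => Subtype.ext (funext fun z => ?_)
  exact mul_left_comm _ _ _

/-- Multiplication operators depend linearly on the function. -/
def mulOpLinear (U : Opens (ℂ × ℂ)) : SmoothFn U →ₗ[ℂ] Op U where
  toFun := mulOp
  map_add' f g := by
    ext h z
    exact add_mul _ _ _
  map_smul' c f := by
    ext h z
    exact mul_assoc _ _ _

theorem derivOp_mulOp (v : ℂ × ℂ) (f : SmoothFn U) :
    derivOp v * mulOp f = mulOp f * derivOp v + mulOp (derivOp v f) := by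
  refine LinearMap.ext fun g => SmoothFn.ext_on fun z hz => ?_
  change (derivOp v (mulOp f g)).1 z = f.1 z * (derivOp v g).1 z + (derivOp v f).1 z * g.1 z
  rw [derivOp_apply _ _ hz, derivOp_apply _ _ hz, derivOp_apply _ _ hz]
  change fderiv ℂ (f.1 * g.1) z v = _
  rw [fderiv_mul (differentiableAt_of_mem f hz) (differentiableAt_of_mem g hz)]
  simp [mul_comm]

theorem derivOp_comm (v w : ℂ × ℂ) : (derivOp v : Op U) * derivOp w = derivOp w * derivOp v := by
  refine LinearMap.ext fun f => SmoothFn.ext_on fun z hz => ?_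
  have key : ∀ v w : ℂ × ℂ,
      (derivOp v (derivOp w f)).1 z = fderiv ℂ (fderiv ℂ f.1) z v w := by
    intro v w
    rw [derivOp_apply _ _ hz]
    have h : (derivOp w f).1 =ᶠ[nhds z] fun z => fderiv ℂ f.1 z w := by
      filter_upwards [U.isOpen.mem_nhds hz] with y hy using derivOp_apply w f hy
    have hd : DifferentiableAt ℂ (fderiv ℂ f.1) z :=
      (((contDiffOn_infty_iff_fderiv_of_isOpen U.isOpen).1 f.2.1).2.differentiableOn
        (by simp)).differentiableAt (U.isOpen.mem_nhds hz)
    rw [h.fderiv_eq, fderiv_clm_apply hd (differentiableAt_const _)]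
    simp
  change (derivOp v (derivOp w f)).1 z = (derivOp w (derivOp v f)).1 z
  rw [key, key]
  have hc : ContDiffAt ℂ ∞ f.1 z := f.2.1.contDiffAt (U.isOpen.mem_nhds hz)
  have hs : IsSymmSndFDerivAt ℂ f.1 z := hc.isSymmSndFDerivAt (by
    rw [minSmoothness_of_isRCLikeNormedField]
    exact WithTop.coe_le_coe.2 le_top)
  exact hs v w

theorem mulOp_one : mulOp (mono U 0 0) = 1 := by
  refine LinearMap.ext fun g => SmoothFn.ext_on fun z hz => ?_
  rw [mulOp_apply, mono_apply _ _ hz]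
  simp

theorem mulOp_zero : mulOp (0 : SmoothFn U) = 0 := (mulOpLinear U).map_zero

theorem dx_mul_X : (dx : Op U) * X = X * dx + 1 := by
  rw [dx, X, derivOp_mulOp, ← dx, dx_mono]
  simp [mulOp_one]

theorem commute_dx_Y : Commute (dx : Op U) Y := by
  change dx * Y = Y * dx
  rw [dx, Y, derivOp_mulOp, ← dx, dx_mono]
  simp [mulOp_zero]

theorem commute_dy_X : Commute (dy : Op U) X := by
  change dy * X = X * dy
  rw [dy, X, derivOp_mulOp, ← dy, dy_mono]
  simp [mulOp_zero]

theorem commute_X_Y : Commute (X : Op U) Y := mulOp_comm _ _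

theorem commute_dx_dy : Commute (dx : Op U) dy := derivOp_comm _ _

theorem X_pow (a : ℕ) : (X : Op U) ^ a = mulOp (mono U a 0) := by
  induction a with
  | zero => rw [pow_zero, mulOp_one]
  | succ a ih => rw [pow_succ, ih, X, mulOp_mulOp, mulOp_mono_mono]

theorem Y_pow (b : ℕ) : (Y : Op U) ^ b = mulOp (mono U 0 b) := by
  induction b with
  | zero => rw [pow_zero, mulOp_one]
  | succ a ih => rw [pow_succ, ih, Y, mulOp_mulOp, mulOp_mono_mono]

theorem mulOp_mono (a b : ℕ) : mulOp (mono U a b) = X ^ a * Y ^ b := by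
  rw [X_pow, Y_pow, mulOp_mulOp, mulOp_mono_mono, add_zero, zero_add]

theorem X_pow_mono (a i j : ℕ) : ((X : Op U) ^ a) (mono U i j) = mono U (a + i) j := by
  rw [X_pow, mulOp_mono_mono, zero_add]

theorem Y_pow_mono (b i j : ℕ) : ((Y : Op U) ^ b) (mono U i j) = mono U i (b + j) := by
  rw [Y_pow, mulOp_mono_mono, zero_add]

theorem dx_pow_mono (s i j : ℕ) :
    ((dx : Op U) ^ s) (mono U i j) = (i.descFactorial s : ℂ) • mono U (i - s) j := by
  induction s with
  | zero => simp
  | succ s ih =>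
    rw [pow_succ', Module.End.mul_apply, ih, map_smul, dx_mono, smul_smul,
      Nat.descFactorial_succ, Nat.sub_sub]
    push_cast
    rw [mul_comm]

theorem dy_pow_mono (t i j : ℕ) :
    ((dy : Op U) ^ t) (mono U i j) = (j.descFactorial t : ℂ) • mono U i (j - t) := by
  induction t with
  | zero => simp
  | succ s ih =>
    rw [pow_succ', Module.End.mul_apply, ih, map_smul, dy_mono, smul_smul,
      Nat.descFactorial_succ, Nat.sub_sub]
    push_cast
    rw [mul_comm]

theorem X_dx_mono (i j : ℕ) : (X * dx : Op U) (mono U i j) = (i : ℂ) • mono U i j := by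
  rw [Module.End.mul_apply, dx_mono, map_smul, ← pow_one X, X_pow_mono]
  rcases i with _ | i
  · simp
  · simp [add_comm]

theorem Y_dy_mono (i j : ℕ) : (Y * dy : Op U) (mono U i j) = (j : ℂ) • mono U i j := by
  rw [Module.End.mul_apply, dy_mono, map_smul, ← pow_one Y, Y_pow_mono]
  rcases j with _ | i
  · simp
  · simp [add_comm]

theorem mono_ne_zero (hU : (U : Set (ℂ × ℂ)).Nonempty) (i j : ℕ) : mono U i j ≠ 0 := by
  intro h
  obtain ⟨z, hz⟩ := hU
  have h1 : ((dx : Op U) ^ i) (((dy : Op U) ^ j) (mono U i j)) = 0 := by simp [h]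
  rw [dy_pow_mono, map_smul, dx_pow_mono, smul_smul] at h1
  have h2 := congrArg (fun f : SmoothFn U => f.1 z) h1
  change _ * (mono U (i - i) (j - j)).1 z = 0 at h2
  rw [mono_apply _ _ hz] at h2
  simp at h2

/-- On a nonempty open set the monomials are linearly independent: they are eigenvectors of
`x ∂_x + √-1 y ∂_y` with distinct eigenvalues. -/
theorem linearIndependent_mono (hU : (U : Set (ℂ × ℂ)).Nonempty) :
    LinearIndependent ℂ (fun m : ℕ × ℕ => mono U m.1 m.2) := by
  refine Module.End.eigenvectors_linearIndependent' ((X : Op U) * dx + Complex.I • (Y * dy))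
    (fun m : ℕ × ℕ => (m.1 : ℂ) + Complex.I * m.2) ?_ _ fun m => ⟨?_, mono_ne_zero hU _ _⟩
  · intro m m' h
    have h1 := congrArg Complex.re h
    have h2 := congrArg Complex.im h
    simp at h1 h2
    exact Prod.ext h1 h2
  · rw [Module.End.mem_eigenspace_iff, LinearMap.add_apply, X_dx_mono, LinearMap.smul_apply,
      Y_dy_mono, smul_smul, add_smul]

/-! ### Normally ordered monomials -/

theorem Op.sub_eq (D E : Op U) : D - E = D + (-1 : ℂ) • E := by
  refine LinearMap.ext fun f => ?_
  simp [sub_eq_add_neg]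

/-- Solves a product formula for its leading term. Every peeling step below uses it. -/
theorem Op.eq_add_neg_smul {D E F : Op U} {c : ℂ} (h : F = D + c • E) : D = F + (-c) • E := by
  rw [h, add_assoc, ← add_smul, add_neg_cancel, zero_smul, add_zero]

/-- The normally ordered operator `x^a y^b ∂_x^s ∂_y^t`. -/
def weylMono (U : Opens (ℂ × ℂ)) (a b s t : ℕ) : Op U := mulOp (mono U a b) * dx ^ s * dy ^ t

theorem weylMono_zero : weylMono U 0 0 0 0 = 1 := by
  simp [weylMono, mulOp_one]

theorem X_pow_mul_weylMono (c a b s t : ℕ) :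
    X ^ c * weylMono U a b s t = weylMono U (c + a) b s t := by
  simp only [weylMono, mulOp_mono, pow_add, mul_assoc]

theorem Y_mul_weylMono (a b s t : ℕ) : Y * weylMono U a b s t = weylMono U a (b + 1) s t := by
  simp only [weylMono, mulOp_mono, pow_succ', ← mul_assoc]
  rw [(commute_X_Y.pow_left a).eq]

theorem dx_mul_weylMono (a b s t : ℕ) :
    dx * weylMono U a b s t = weylMono U a b (s + 1) t + (a : ℂ) • weylMono U (a - 1) b s t := by
  have h : dx * mulOp (mono U a b) =
      mulOp (mono U a b) * dx + (a : ℂ) • mulOp (mono U (a - 1) b) := by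
    rw [dx, derivOp_mulOp, ← dx, dx_mono]
    exact congrArg _ ((mulOpLinear U).map_smul _ _)
  simp only [weylMono, ← mul_assoc, h, add_mul, smul_mul_assoc, pow_succ']

theorem dy_mul_weylMono (a b s t : ℕ) :
    dy * weylMono U a b s t = weylMono U a b s (t + 1) + (b : ℂ) • weylMono U a (b - 1) s t := by
  have h : dy * mulOp (mono U a b) =
      mulOp (mono U a b) * dy + (b : ℂ) • mulOp (mono U a (b - 1)) := by
    rw [dy, derivOp_mulOp, ← dy, dy_mono]
    exact congrArg _ ((mulOpLinear U).map_smul _ _)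
  have h2 : (dy : Op U) * dx ^ s = dx ^ s * dy := ((commute_dx_dy.pow_left s).eq).symm
  simp only [weylMono, ← mul_assoc, h, add_mul, smul_mul_assoc, pow_succ']
  rw [mul_assoc _ dy, h2, ← mul_assoc]

theorem X_dx_mul_weylMono (a b s t : ℕ) :
    X * dx * weylMono U a b s t =
      weylMono U (a + 1) b (s + 1) t + (a : ℂ) • weylMono U a b s t := by
  rw [mul_assoc, dx_mul_weylMono, mul_add, mul_smul_comm, ← pow_one X, X_pow_mul_weylMono,
    X_pow_mul_weylMono, add_comm 1 a]
  rcases a with _ | a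
  · simp
  · simp [add_comm]

theorem Y_dy_mul_weylMono (a b s t : ℕ) :
    Y * dy * weylMono U a b s t =
      weylMono U a (b + 1) s (t + 1) + (b : ℂ) • weylMono U a b s t := by
  rw [mul_assoc, dy_mul_weylMono, mul_add, mul_smul_comm, Y_mul_weylMono, Y_mul_weylMono]
  rcases b with _ | b
  · simp
  · simp

theorem X_pow_dy_mul_weylMono (c a b s t : ℕ) :
    X ^ c * dy * weylMono U a b s t =
      weylMono U (c + a) b s (t + 1) + (b : ℂ) • weylMono U (c + a) (b - 1) s t := by
  rw [mul_assoc, dy_mul_weylMono, mul_add, mul_smul_comm, X_pow_mul_weylMono, X_pow_mul_weylMono]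

theorem weylMono_mono (a b s t i j : ℕ) :
    weylMono U a b s t (mono U i j) =
      ((i.descFactorial s * j.descFactorial t : ℕ) : ℂ) • mono U (a + (i - s)) (b + (j - t)) := by
  rw [weylMono, Module.End.mul_apply, Module.End.mul_apply, dy_pow_mono, map_smul, dx_pow_mono,
    map_smul, map_smul, mulOp_mono_mono, smul_smul]
  push_cast
  rw [mul_comm]

/-! ### Differential operators with polynomial coefficients -/

/-- The differential operator with given coefficients. -/
def ofCoeff (U : Opens (ℂ × ℂ)) : (ℕ × ℕ →₀ SmoothFn U) →ₗ[ℂ] Op U :=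
  Finsupp.lsum ℂ fun m =>
    (LinearMap.mulRight ℂ (dx ^ m.1 * dy ^ m.2 : Op U)).comp (mulOpLinear U)

theorem ofCoeff_apply (f : ℕ × ℕ →₀ SmoothFn U) :
    ofCoeff U f = ∑ m ∈ f.support, mulOp (f m) * (dx ^ m.1 * dy ^ m.2) := by
  rw [ofCoeff, Finsupp.lsum_apply]
  rfl

theorem exists_ofCoeff_eq {I : Set (ℕ × ℕ)} {D : Op U} (hD : D ∈ diffOps U I) :
    ∃ f : ℕ × ℕ →₀ SmoothFn U, (∀ m ∈ f.support, m ∈ I) ∧ ofCoeff U f = D := by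
  have h : diffOps U I ≤ (Finsupp.supported (SmoothFn U) ℂ I).map (ofCoeff U) := by
    refine Submodule.span_le.2 ?_
    rintro _ ⟨f, s, t, hst, rfl⟩
    refine ⟨Finsupp.single (s, t) f, Finsupp.single_mem_supported ℂ f hst, ?_⟩
    rw [ofCoeff, Finsupp.lsum_single]
    exact (mul_assoc _ _ _).symm
  obtain ⟨f, hf, hfD⟩ := h hD
  exact ⟨f, fun m hm => hf hm, hfD⟩

/-- The polynomial functions of degree at most `t` in `y`. -/
def yPolys (U : Opens (ℂ × ℂ)) (t : ℕ) : Submodule ℂ (SmoothFn U) :=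
  Submodule.span ℂ {g | ∃ i' j' : ℕ, j' ≤ t ∧ g = mono U i' j'}

theorem mulOp_mono_mem_yPolys {t u : ℕ} {f : SmoothFn U} (hf : f ∈ yPolys U t) (i j : ℕ)
    (h : t + j ≤ u) : mulOp f (mono U i j) ∈ yPolys U u := by
  have : yPolys U t ≤ (yPolys U u).comap
      ((LinearMap.applyₗ (mono U i j)).comp (mulOpLinear U)) := by
    refine Submodule.span_le.2 ?_
    rintro _ ⟨a, b, hb, rfl⟩
    refine Submodule.subset_span ⟨a + i, b + j, by omega, mulOp_mono_mono a b i j⟩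
  exact this hf

/-- Triangularity: at `x^s y^t` only coefficients with index at most `(s, t)` contribute. Those
other than `f (s, t)` have lower order and are known by induction, while `f (s, t)` itself appears
with the nonzero factor `s! t!`. -/
theorem coeff_mem_yPolys {f : ℕ × ℕ →₀ SmoothFn U}
    (hf : ∀ i j, ofCoeff U f (mono U i j) ∈ yPolys U j) (m : ℕ × ℕ) : f m ∈ yPolys U m.2 := by
  induction hn : m.1 + m.2 using Nat.strong_induction_on generalizing m with
  | _ n ih =>
  obtain ⟨s, t⟩ := m
  by_cases hm : (s, t) ∈ f.support
  swap
  · rw [Finsupp.notMem_support_iff.1 hm]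
    exact zero_mem _
  have hterm : ∀ m : ℕ × ℕ, (mulOp (f m) * (dx ^ m.1 * dy ^ m.2) : Op U) (mono U s t) =
      ((s.descFactorial m.1 * t.descFactorial m.2 : ℕ) : ℂ) •
        mulOp (f m) (mono U (s - m.1) (t - m.2)) := by
    intro m
    rw [Module.End.mul_apply, Module.End.mul_apply, dy_pow_mono, map_smul, dx_pow_mono,
      smul_smul, map_smul]
    push_cast
    rw [mul_comm]
  have h := hf s t
  rw [ofCoeff_apply, LinearMap.sum_apply, ← Finset.add_sum_erase _ _ hm, hterm] at h
  have h2 : ∑ m ∈ f.support.erase (s, t),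
      (mulOp (f m) * (dx ^ m.1 * dy ^ m.2) : Op U) (mono U s t) ∈
      yPolys U t := by
    refine Submodule.sum_mem _ fun m hm' => ?_
    rw [hterm]
    by_cases h1 : m.1 ≤ s
    swap
    · simp [Nat.descFactorial_of_lt (not_le.1 h1)]
    by_cases h2 : m.2 ≤ t
    swap
    · simp [Nat.descFactorial_of_lt (not_le.1 h2)]
    refine Submodule.smul_mem _ _ (mulOp_mono_mem_yPolys (ih _ ?_ m rfl) _ _ (by omega))
    have h3 : ¬ (m.1 = s ∧ m.2 = t) := fun h => (Finset.mem_erase.1 hm').1 (Prod.ext h.1 h.2)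
    simp only at hn
    omega
  have h3 := (Submodule.add_mem_iff_left _ h2).1 h
  have h4 : ((s.descFactorial s * t.descFactorial t : ℕ) : ℂ) ≠ 0 := by
    rw [Nat.descFactorial_self, Nat.descFactorial_self]
    exact_mod_cast mul_ne_zero s.factorial_ne_zero t.factorial_ne_zero
  have h5 := (Submodule.smul_mem_iff _ h4).1 h3
  have h6 : mulOp (f (s, t)) (mono U (s - s) (t - t)) = f (s, t) := by
    refine SmoothFn.ext_on fun z hz => ?_
    rw [mulOp_apply, mono_apply _ _ hz]
    simp
  rwa [h6] at h5

/-- Operators of order at most `k` and nonpositive `y`-degree have polynomial coefficients. -/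
theorem mem_span_weylMono {k : ℕ} {D : Op U} (hD : D ∈ diffOps U {m | m.1 + m.2 ≤ k})
    (hy : ∀ i j, D (mono U i j) ∈ yPolys U j) :
    D ∈ Submodule.span ℂ {E | ∃ a b s t : ℕ, b ≤ t ∧ s + t ≤ k ∧ E = weylMono U a b s t} := by
  obtain ⟨f, hf, rfl⟩ := exists_ofCoeff_eq hD
  rw [ofCoeff_apply]
  refine Submodule.sum_mem _ fun m hm => ?_
  have h : yPolys U m.2 ≤ (Submodule.span ℂ
      {E | ∃ a b s t : ℕ, b ≤ t ∧ s + t ≤ k ∧ E = weylMono U a b s t}).comap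
      ((LinearMap.mulRight ℂ (dx ^ m.1 * dy ^ m.2 : Op U)).comp (mulOpLinear U)) := by
    refine Submodule.span_le.2 ?_
    rintro _ ⟨a, b, hb, rfl⟩
    exact Submodule.subset_span ⟨a, b, m.1, m.2, hb, hf m hm, (mul_assoc _ _ _).symm⟩
  exact h (coeff_mem_yPolys hy m)

/-! ### Filtrations stable under the first-order generators -/

/-- An increasing sequence of spaces of operators that contains `1` and is shifted by left
multiplication with the operators `J^i_c`. -/
structure IsGenFiltration (r : ℕ) (c : ℂ) (A : ℕ → Submodule ℂ (Op U)) : Prop where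
  one_mem : 1 ∈ A 0
  mono : Monotone A
  dx_mul : ∀ {n D}, D ∈ A n → dx * D ∈ A (n + 1)
  X_dx_mul : ∀ {n D}, D ∈ A n → X * dx * D ∈ A (n + 1)
  Y_dy_mul : ∀ {n D}, D ∈ A n → Y * dy * D ∈ A (n + 1)
  X_pow_dy_mul : ∀ {n D i}, i ≤ r → D ∈ A n → X ^ i * dy * D ∈ A (n + 1)
  J2_mul : ∀ {n D}, D ∈ A n → J2 r c * D ∈ A (n + 1)

/-- Peel a first-order factor of nonpositive weight off the left. The commutator correction has the
same weight and lower order, so induction on the order covers both terms. -/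
theorem IsGenFiltration.weylMono_mem {r : ℕ} {c : ℂ} {A : ℕ → Submodule ℂ (Op U)}
    (hA : IsGenFiltration r c A) {a b s t : ℕ} (hbt : b ≤ t) (h : a + r * b ≤ s + r * t) :
    weylMono U a b s t ∈ A (s + t) := by
  induction hn : s + t generalizing a b s t with
  | zero =>
    obtain ⟨rfl, rfl⟩ : s = 0 ∧ t = 0 := by omega
    obtain rfl : b = 0 := by omega
    obtain rfl : a = 0 := by simpa using h
    rw [weylMono_zero]
    exact hA.one_mem
  | succ n ih =>
    have hle : A n ≤ A (n + 1) := hA.mono n.le_succ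
    rcases hbt.lt_or_eq with hlt | rfl
    · obtain ⟨t, rfl⟩ : ∃ t', t = t' + 1 := ⟨t - 1, by omega⟩
      have hmul : r * b ≤ r * t := Nat.mul_le_mul_left r (by omega)
      rw [mul_add_one] at h
      -- Taking as many powers of `x` as `x^i ∂y` allows keeps the weight of the remaining factor
      -- nonpositive: either `∂y` is fully compensated, or no `x` is left and `b ≤ t` suffices.
      have h1 := X_pow_dy_mul_weylMono (U := U) (min a r) (a - min a r) b s t
      rw [Nat.add_sub_cancel' (min_le_left a r)] at h1
      rw [Op.eq_add_neg_smul h1]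
      refine Submodule.add_mem _ (hA.X_pow_dy_mul (min_le_right a r)
        (ih (by omega) (by omega) (by omega))) ?_
      rcases b with _ | b
      · simp
      · refine Submodule.smul_mem _ _ (hle (ih (by omega) ?_ (by omega)))
        rw [Nat.add_sub_cancel]
        rw [mul_add_one] at h
        omega
    · have has : a ≤ s := by omega
      rcases b with _ | b
      · obtain ⟨s, rfl⟩ : ∃ s', s = s' + 1 := ⟨s - 1, by omega⟩
        rcases a with _ | a
        · have h1 := dx_mul_weylMono (U := U) 0 0 s 0
          simp only [Nat.cast_zero, zero_smul, add_zero] at h1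
          rw [← h1]
          exact hA.dx_mul (ih le_rfl (by omega) (by omega))
        · rw [Op.eq_add_neg_smul (X_dx_mul_weylMono (U := U) a 0 s 0)]
          have h2 := ih (a := a) (b := 0) (s := s) (t := 0) le_rfl (by omega) (by omega)
          exact Submodule.add_mem _ (hA.X_dx_mul h2) (Submodule.smul_mem _ _ (hle h2))
      · rw [Op.eq_add_neg_smul (Y_dy_mul_weylMono (U := U) a b s b)]
        have h2 := ih (a := a) (b := b) (s := s) (t := b) le_rfl (by omega) (by omega)
        exact Submodule.add_mem _ (hA.Y_dy_mul h2) (Submodule.smul_mem _ _ (hle h2))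

/-! ### The Newton basis -/

/-- The operator `c - x ∂_x - r y ∂_y`. -/
def coweight (U : Opens (ℂ × ℂ)) (r : ℕ) (c : ℂ) : Op U :=
  c • 1 + (-1 : ℂ) • (X * dx) + (-r : ℂ) • (Y * dy)

/-- The falling factorial `V (V - 1) ⋯ (V - a + 1)` of an operator. -/
def falling (V : Op U) : ℕ → Op U
  | 0 => 1
  | a + 1 => falling V a * (V + (-a : ℂ) • 1)

theorem commute_falling {V D : Op U} (h : Commute D V) (a : ℕ) : Commute D (falling V a) := by
  induction a with
  | zero => exact Commute.one_right D
  | succ a ih => exact ih.mul_right (h.add_right ((Commute.one_right D).smul_right _))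

theorem falling_apply {V : Op U} {μ : ℂ} {g : SmoothFn U} (h : V g = μ • g) (a : ℕ) :
    falling V a g = (descPochhammer ℂ a).eval μ • g := by
  induction a with
  | zero => simp [falling]
  | succ a ih =>
    rw [falling, Module.End.mul_apply, LinearMap.add_apply, h, LinearMap.smul_apply,
      Module.End.one_apply, ← add_smul, map_smul, ih, smul_smul, descPochhammer_succ_eval,
      mul_comm, sub_eq_add_neg]

/-- For `c = P` the eigenvalue is the distance from `(i, j)` to the slanted edge of the staircase.
-/
theorem coweight_mono (r : ℕ) (c : ℂ) (i j : ℕ) :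
    coweight U r c (mono U i j) = (c - i - r * j) • mono U i j := by
  rw [coweight, LinearMap.add_apply, LinearMap.add_apply, LinearMap.smul_apply,
    LinearMap.smul_apply, LinearMap.smul_apply, X_dx_mono, Y_dy_mono, Module.End.one_apply]
  module

theorem X_dx_eq (r : ℕ) (c : ℂ) :
    (X * dx : Op U) = c • 1 + (-1 : ℂ) • coweight U r c + (-r : ℂ) • (Y * dy) := by
  rw [coweight]
  module

theorem commute_Y_dy_coweight (r : ℕ) (c : ℂ) : Commute (Y * dy : Op U) (coweight U r c) := by
  have h1 : Commute (Y * dy : Op U) (X * dx) :=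
    (commute_X_Y.symm.mul_right commute_dx_Y.symm).mul_left
      (commute_dy_X.mul_right commute_dx_dy.symm)
  exact (((Commute.one_right _).smul_right _).add_right (h1.smul_right _)).add_right
    ((Commute.refl _).smul_right _)

theorem coweight_mul_X (r : ℕ) (c : ℂ) :
    coweight U r c * X = X * (coweight U r c + (-1 : ℂ) • 1) := by
  have h1 : (Y * dy * X : Op U) = X * (Y * dy) := by
    rw [mul_assoc, commute_dy_X.eq, ← mul_assoc, ← commute_X_Y.eq, mul_assoc]
  simp only [coweight, add_mul, mul_add, smul_mul_assoc, mul_smul_comm, h1, mul_one, one_mul]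
  rw [mul_assoc X dx X, dx_mul_X, mul_add, mul_one]
  module

theorem coweight_mul_X_pow (r : ℕ) (c : ℂ) (e : ℕ) :
    coweight U r c * X ^ e = X ^ e * (coweight U r c + (-e : ℂ) • 1) := by
  induction e with
  | zero => simp
  | succ e ih =>
    rw [pow_succ, ← mul_assoc, ih, mul_assoc, add_mul, coweight_mul_X, smul_mul_assoc, one_mul,
      mul_assoc]
    congr 1
    simp only [mul_add, mul_smul_comm, mul_one, Nat.cast_add, Nat.cast_one]
    module

theorem J2_eq (r : ℕ) (c : ℂ) : (J2 r c : Op U) = (-1 : ℂ) • (X * coweight U r c) := by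
  rw [J2, coweight, Op.sub_eq, mul_add, mul_add, mul_smul_comm, mul_smul_comm, mul_smul_comm,
    mul_one, pow_two, mul_assoc X X dx, mul_assoc X Y dy]
  module

/-- As `J2 = -x V` and `V x^e = x^e (V - e)`, moving the powers of `x` to the left in `(x V)^e`
produces the falling factorial. -/
theorem X_pow_mul_falling (r : ℕ) (c : ℂ) (e : ℕ) :
    X ^ e * falling (coweight U r c) e = (-1 : ℂ) ^ e • J2 r c ^ e := by
  induction e with
  | zero => simp [falling]
  | succ e ih =>
    have h1 : Commute (coweight U r c + (-e : ℂ) • 1) (falling (coweight U r c) e) :=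
      commute_falling ((Commute.refl _).add_left ((Commute.one_left _).smul_left _)) e
    rw [falling, ← h1.eq, pow_succ', ← mul_assoc, mul_assoc X, ← coweight_mul_X_pow,
      mul_assoc, mul_assoc, ih, mul_smul_comm, mul_smul_comm, ← mul_assoc, pow_succ' (J2 r c),
      pow_succ' (-1 : ℂ), J2_eq, smul_mul_assoc, smul_smul]
    congr 1
    ring

theorem IsGenFiltration.coweight_add_mul {r : ℕ} {c : ℂ} {A : ℕ → Submodule ℂ (Op U)}
    (hA : IsGenFiltration r c A) (l : ℂ) {n : ℕ} {D : Op U} (hD : D ∈ A n) :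
    (coweight U r c + l • 1) * D ∈ A (n + 1) := by
  have hle : D ∈ A (n + 1) := hA.mono n.le_succ hD
  simp only [coweight, add_mul, smul_mul_assoc, one_mul]
  exact Submodule.add_mem _ (Submodule.add_mem _ (Submodule.add_mem _ (Submodule.smul_mem _ _ hle)
    (Submodule.smul_mem _ _ (hA.X_dx_mul hD))) (Submodule.smul_mem _ _ (hA.Y_dy_mul hD)))
    (Submodule.smul_mem _ _ hle)

/-- The first `e` factors of the falling factorial combine with `x^e` into powers of `J2`. Each
further factor `V - l` is of first order and is absorbed into `D`. -/
theorem IsGenFiltration.X_pow_mul_falling_mul {r : ℕ} {c : ℂ} {A : ℕ → Submodule ℂ (Op U)}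
    (hA : IsGenFiltration r c A) {e a n : ℕ} {D : Op U} (hea : e ≤ a) (hD : D ∈ A n) :
    X ^ e * falling (coweight U r c) a * D ∈ A (a + n) := by
  induction a, hea using Nat.le_induction generalizing n D with
  | base =>
    rw [X_pow_mul_falling, smul_mul_assoc]
    refine Submodule.smul_mem _ _ ?_
    induction e with
    | zero => simpa using hD
    | succ e ih =>
      rw [pow_succ', mul_assoc, add_right_comm]
      exact hA.J2_mul ih
  | succ a _ ih =>
    rw [falling, ← mul_assoc, mul_assoc]
    have := ih (hA.coweight_add_mul (-a : ℂ) hD)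
    rwa [← add_assoc, add_right_comm] at this

/-- A Newton basis operator: it maps `x^i y^j` to `u^{(a)} j^{(b+d)} x^{m+rd+i} y^{j-d}`, where
`u = c - i - r j` and upper indices in parentheses denote falling factorials. -/
def newtonOp (U : Opens (ℂ × ℂ)) (r : ℕ) (c : ℂ) (m d a b : ℕ) : Op U :=
  X ^ m * (falling (coweight U r c) a * weylMono U (r * d) b 0 (b + d))

theorem mul_falling (V : Op U) (a : ℕ) :
    V * falling V a = falling V (a + 1) + (a : ℂ) • falling V a := by
  rw [(commute_falling (Commute.refl V) a).eq, falling, mul_add, mul_smul_comm, mul_one]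
  module

/-- The span of the Newton basis operators with `m = 0` of bounded order. -/
def newtonSpan (U : Opens (ℂ × ℂ)) (r : ℕ) (c : ℂ) (d n : ℕ) : Submodule ℂ (Op U) :=
  Submodule.span ℂ {E | ∃ a b : ℕ, a + b ≤ n ∧
    E = falling (coweight U r c) a * weylMono U (r * d) b 0 (b + d)}

theorem falling_mul_mem_newtonSpan (r : ℕ) (c : ℂ) (d : ℕ) {n a b : ℕ} (h : a + b ≤ n) :
    falling (coweight U r c) a * weylMono U (r * d) b 0 (b + d) ∈ newtonSpan U r c d n :=
  Submodule.subset_span ⟨a, b, h, rfl⟩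

theorem newtonSpan_mono (r : ℕ) (c : ℂ) (d : ℕ) {n n' : ℕ} (h : n ≤ n') :
    newtonSpan U r c d n ≤ newtonSpan U r c d n' := by
  refine Submodule.span_mono ?_
  rintro _ ⟨a, b, h', rfl⟩
  exact ⟨a, b, h'.trans h, rfl⟩

/-- Substitute `x ∂x = c - V - r y ∂y`: multiplication by `V` raises `a`, and `y ∂y` commutes with
`V` and raises `b`, up to lower terms. -/
theorem X_dx_mul_mem_newtonSpan (r : ℕ) (c : ℂ) (d : ℕ) {n : ℕ} {D : Op U}
    (hD : D ∈ newtonSpan U r c d n) : X * dx * D ∈ newtonSpan U r c d (n + 1) := by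
  have h : newtonSpan U r c d n ≤
      (newtonSpan U r c d (n + 1)).comap (LinearMap.mulLeft ℂ (X * dx : Op U)) := by
    refine Submodule.span_le.2 ?_
    rintro _ ⟨a, b, h, rfl⟩
    have hmem : ∀ {a b : ℕ}, a + b ≤ n + 1 →
        falling (coweight U r c) a * weylMono U (r * d) b 0 (b + d) ∈
          newtonSpan U r c d (n + 1) := falling_mul_mem_newtonSpan r c d
    rw [SetLike.mem_coe, Submodule.mem_comap, LinearMap.mulLeft_apply, X_dx_eq r c, add_mul,
      add_mul, smul_mul_assoc, smul_mul_assoc, smul_mul_assoc, one_mul, ← mul_assoc,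
      ← mul_assoc (Y * dy), mul_falling, (commute_falling (commute_Y_dy_coweight r c) a).eq,
      mul_assoc, Y_dy_mul_weylMono, add_mul, smul_mul_assoc, mul_add, mul_smul_comm,
      add_right_comm b d 1]
    exact Submodule.add_mem _ (Submodule.add_mem _ (Submodule.smul_mem _ _ (hmem (by omega)))
      (Submodule.smul_mem _ _ (Submodule.add_mem _ (hmem (by omega))
        (Submodule.smul_mem _ _ (hmem (by omega))))))
      (Submodule.smul_mem _ _ (Submodule.add_mem _ (hmem (by omega))
        (Submodule.smul_mem _ _ (hmem (by omega)))))
  exact h hD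

theorem weylMono_mem_newtonSpan (r : ℕ) (c : ℂ) (d b s : ℕ) :
    weylMono U (r * d + s) b s (b + d) ∈ newtonSpan U r c d (s + b) := by
  induction s with
  | zero =>
    have h := falling_mul_mem_newtonSpan (U := U) r c d (zero_add b).le
    rw [falling, one_mul] at h
    rwa [add_zero, zero_add]
  | succ s ih =>
    rw [← add_assoc, Op.eq_add_neg_smul (X_dx_mul_weylMono (U := U) (r * d + s) b s (b + d)),
      add_right_comm s 1 b]
    exact Submodule.add_mem _ (X_dx_mul_mem_newtonSpan r c d ih)
      (Submodule.smul_mem _ _ (newtonSpan_mono r c d (Nat.le_succ _) ih))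

theorem weylMono_mem_span_newtonOp (r : ℕ) (c : ℂ) (m d b s : ℕ) :
    weylMono U (m + (r * d + s)) b s (b + d) ∈ Submodule.span ℂ
      {E | ∃ a b' : ℕ, a + b' ≤ s + b ∧ E = newtonOp U r c m d a b'} := by
  have h : newtonSpan U r c d (s + b) ≤
      (Submodule.span ℂ {E | ∃ a b' : ℕ, a + b' ≤ s + b ∧ E = newtonOp U r c m d a b'}).comap
        (LinearMap.mulLeft ℂ (X ^ m : Op U)) := by
    refine Submodule.span_le.2 ?_
    rintro _ ⟨a, b', h, rfl⟩
    exact Submodule.subset_span ⟨a, b', h, rfl⟩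
  have h2 := h (weylMono_mem_newtonSpan r c d b s)
  rw [Submodule.mem_comap, LinearMap.mulLeft_apply, X_pow_mul_weylMono] at h2
  exact h2

theorem newtonOp_mono {r P i j : ℕ} (hij : i + r * j ≤ P) (m d a b : ℕ) :
    newtonOp U r P m d a b (mono U i j) =
      (((P - (i + r * j)).descFactorial a * j.descFactorial (b + d) : ℕ) : ℂ) •
        mono U (m + (r * d + i)) (j - d) := by
  rw [newtonOp, Module.End.mul_apply, Module.End.mul_apply, weylMono_mono, map_smul, map_smul]
  by_cases hj : j < b + d
  · simp [Nat.descFactorial_of_lt hj]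
  have h1 : b + (j - (b + d)) = j - d := by omega
  -- The shift by `x^{rd} y^{-d}` has weight zero, so the distance to the edge is unchanged.
  have h2 : coweight U r P (mono U (r * d + i) (j - d)) =
      ((P - (i + r * j) : ℕ) : ℂ) • mono U (r * d + i) (j - d) := by
    rw [coweight_mono]
    congr 1
    push_cast [Nat.cast_sub hij, Nat.cast_sub (show d ≤ j by omega)]
    ring
  rw [Nat.sub_zero, h1, falling_apply h2, map_smul, X_pow_mono, smul_smul,
    descPochhammer_eval_eq_descFactorial, Nat.descFactorial_zero, one_mul]
  push_cast
  rw [mul_comm]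

/-! ### Closure properties of differential operators -/

theorem dx_mul_mem_diffOps {D : Op U} (hD : D ∈ diffOps U Set.univ) :
    dx * D ∈ diffOps U Set.univ := by
  have h : diffOps U Set.univ ≤ (diffOps U Set.univ).comap (LinearMap.mulLeft ℂ dx) := by
    refine Submodule.span_le.2 ?_
    rintro _ ⟨f, s, t, -, rfl⟩
    rw [SetLike.mem_coe, Submodule.mem_comap, LinearMap.mulLeft_apply, ← mul_assoc, ← mul_assoc,
      dx, derivOp_mulOp, ← dx, add_mul, add_mul, mul_assoc _ dx,
      ← pow_succ']
    exact Submodule.add_mem _ (Submodule.subset_span ⟨_, _, _, trivial, rfl⟩)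
      (Submodule.subset_span ⟨_, _, _, trivial, rfl⟩)
  exact h hD

theorem dy_mul_mem_diffOps {D : Op U} (hD : D ∈ diffOps U Set.univ) :
    dy * D ∈ diffOps U Set.univ := by
  have h : diffOps U Set.univ ≤ (diffOps U Set.univ).comap (LinearMap.mulLeft ℂ dy) := by
    refine Submodule.span_le.2 ?_
    rintro _ ⟨f, s, t, -, rfl⟩
    rw [SetLike.mem_coe, Submodule.mem_comap, LinearMap.mulLeft_apply, ← mul_assoc, ← mul_assoc,
      dy, derivOp_mulOp, ← dy, add_mul, add_mul, mul_assoc _ dy,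
      ((commute_dx_dy (U := U)).symm.pow_right s).eq, ← mul_assoc, mul_assoc _ dy, ← pow_succ']
    exact Submodule.add_mem _ (Submodule.subset_span ⟨_, _, _, trivial, rfl⟩)
      (Submodule.subset_span ⟨_, _, _, trivial, rfl⟩)
  exact h hD

theorem mulOp_mul_mem_diffOps (f : SmoothFn U) {D : Op U} (hD : D ∈ diffOps U Set.univ) :
    mulOp f * D ∈ diffOps U Set.univ := by
  have h : diffOps U Set.univ ≤ (diffOps U Set.univ).comap (LinearMap.mulLeft ℂ (mulOp f)) := by
    refine Submodule.span_le.2 ?_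
    rintro _ ⟨g, s, t, -, rfl⟩
    rw [SetLike.mem_coe, Submodule.mem_comap, LinearMap.mulLeft_apply, ← mul_assoc, ← mul_assoc,
      mulOp_mulOp]
    exact Submodule.subset_span ⟨_, _, _, trivial, rfl⟩
  exact h hD

theorem newtonOp_mem_diffOps (r : ℕ) (c : ℂ) (m d a b : ℕ) :
    newtonOp U r c m d a b ∈ diffOps U Set.univ := by
  rw [newtonOp, X_pow]
  refine mulOp_mul_mem_diffOps _ ?_
  have h : ∀ D ∈ diffOps U Set.univ, falling (coweight U r c) a * D ∈ diffOps U Set.univ := by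
    induction a with
    | zero => simp [falling]
    | succ a ih =>
      intro D hD
      rw [falling, mul_assoc]
      refine ih _ ?_
      simp only [coweight, add_mul, smul_mul_assoc, one_mul, mul_assoc]
      exact Submodule.add_mem _ (Submodule.add_mem _ (Submodule.add_mem _
        (Submodule.smul_mem _ _ hD)
        (Submodule.smul_mem _ _ (mulOp_mul_mem_diffOps _ (dx_mul_mem_diffOps hD))))
        (Submodule.smul_mem _ _ (mulOp_mul_mem_diffOps _ (dy_mul_mem_diffOps hD))))
        (Submodule.smul_mem _ _ hD)
  exact h _ (Submodule.subset_span ⟨_, _, _, trivial, rfl⟩)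

/-! ### Operators between staircase modules -/

theorem mono_mem_scalarModule {r p q i j : ℕ} (h : (i, j) ∈ stairs r p q) :
    mono U i j ∈ scalarModule U r p q :=
  Submodule.subset_span ⟨i, j, h, rfl⟩

theorem scalarModule_eq_span_image (U : Opens (ℂ × ℂ)) (r p q : ℕ) :
    scalarModule U r p q =
      Submodule.span ℂ ((fun m : ℕ × ℕ => mono U m.1 m.2) '' stairs r p q) := by
  refine congrArg _ (Set.ext fun g => ⟨?_, ?_⟩)
  · rintro ⟨i, j, h, rfl⟩
    exact ⟨(i, j), h, rfl⟩
  · rintro ⟨⟨i, j⟩, h, rfl⟩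
    exact ⟨i, j, h, rfl⟩

theorem map_scalarModule_le {r p q : ℕ} {D : Op U} {S : Submodule ℂ (SmoothFn U)}
    (h : ∀ i j, (i, j) ∈ stairs r p q → D (mono U i j) ∈ S) {f : SmoothFn U}
    (hf : f ∈ scalarModule U r p q) : D f ∈ S := by
  have : scalarModule U r p q ≤ S.comap D := by
    refine Submodule.span_le.2 ?_
    rintro _ ⟨i, j, hij, rfl⟩
    exact h i j hij
  exact this hf

theorem weylMono_map_scalarModule {r P P' q a b s t : ℕ} (hbt : b ≤ t)
    (h : a + r * b + P ≤ s + r * t + P') {f : SmoothFn U} (hf : f ∈ scalarModule U r P q) :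
    weylMono U a b s t f ∈ scalarModule U r P' q := by
  refine map_scalarModule_le (fun i j hij => ?_) hf
  rw [weylMono_mono]
  by_cases hs : i < s
  · simp [Nat.descFactorial_of_lt hs]
  by_cases ht : j < t
  · simp [Nat.descFactorial_of_lt ht]
  refine Submodule.smul_mem _ _ (mono_mem_scalarModule ⟨?_, ?_⟩)
  · obtain ⟨j, rfl⟩ := Nat.exists_eq_add_of_le (not_lt.1 ht)
    have h1 := hij.1
    simp only [Nat.add_sub_cancel_left, mul_add] at h1 ⊢
    omega
  · have := hij.2
    simp only at this ⊢
    omega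

/-- Linear combinations of the Newton basis operators. -/
def ofNewton (U : Opens (ℂ × ℂ)) (r P : ℕ) : (ℕ × ℕ × ℕ × ℕ →₀ ℂ) →ₗ[ℂ] Op U :=
  Finsupp.linearCombination ℂ fun x => newtonOp U r P x.1 x.2.1 x.2.2.1 x.2.2.2

theorem ofNewton_mono {r P i j : ℕ} (hij : i + r * j ≤ P) (c : ℕ × ℕ × ℕ × ℕ →₀ ℂ) :
    ofNewton U r P c (mono U i j) =
      Finsupp.linearCombination ℂ (fun m : ℕ × ℕ => mono U m.1 m.2)
        (∑ x ∈ c.support, Finsupp.single (x.1 + (r * x.2.1 + i), j - x.2.1)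
          (c x * ((P - (i + r * j)).descFactorial x.2.2.1 *
            j.descFactorial (x.2.2.2 + x.2.1) : ℕ))) := by
  rw [ofNewton, Finsupp.linearCombination_apply, Finsupp.sum, LinearMap.sum_apply, map_sum]
  refine Finset.sum_congr rfl fun x _ => ?_
  rw [LinearMap.smul_apply, newtonOp_mono hij, Finsupp.linearCombination_single, smul_smul]

/-- Evaluate at the monomial with `u = a` and `j = b + d`. The image monomial has weight `m + P - a
> P'`, hence lies outside the target, so its total coefficient vanishes by linear independence. -/
theorem newton_coeff_eq_zero (hU : (U : Set (ℂ × ℂ)).Nonempty) {r P P' q : ℕ}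
    {c : ℕ × ℕ × ℕ × ℕ →₀ ℂ}
    (h : ∀ i j, (i, j) ∈ stairs r P q → ofNewton U r P c (mono U i j) ∈ scalarModule U r P' q)
    {m d a b : ℕ} (hm : a + P' < m + P) (hab : a + r * (b + d) ≤ P) (hq : b + d ≤ q) :
    c (m, d, a, b) = 0 := by
  induction hn : a + b using Nat.strong_induction_on generalizing a b with
  | _ n ih =>
  obtain ⟨i, hi⟩ := Nat.exists_eq_add_of_le hab
  have hij : i + r * (b + d) ≤ P := by omega
  have hu : P - (i + r * (b + d)) = a := by omega
  have h1 := h i (b + d) ⟨hij, hq⟩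
  rw [ofNewton_mono hij, scalarModule_eq_span_image,
    Finsupp.mem_span_image_iff_linearCombination] at h1
  obtain ⟨l, hl, hl'⟩ := h1
  have h2 := linearIndependent_mono hU hl'
  have h3 : (m + (r * d + i), b + d - d) ∉ stairs r P' q := by
    rintro ⟨h4, -⟩
    simp only [Nat.add_sub_cancel] at h4
    rw [mul_add] at hi
    omega
  have h4 : l (m + (r * d + i), b + d - d) = 0 := by
    by_contra h5
    exact h3 (hl (Finsupp.mem_support_iff.2 h5))
  rw [h2, Finsupp.finsetSum_apply, hu] at h4
  rw [Finset.sum_eq_single (m, d, a, b)] at h4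
  · simp only [Finsupp.single_eq_same, mul_eq_zero, Nat.cast_eq_zero, Nat.descFactorial_self,
      Nat.factorial_ne_zero, or_false] at h4
    exact h4
  -- Any other term that is nonzero at this monomial has `a' ≤ a` and `b' + d' ≤ b + d`. If it
  -- reaches the same image, then `d' = d`, `m' = m` and `a' + b'` is smaller, so its coefficient is
  -- zero by induction.
  · rintro ⟨m', d', a', b'⟩ - hne
    by_cases ha : a < a'
    · simp [Nat.descFactorial_of_lt ha]
    by_cases hb : b + d < b' + d'
    · simp [Nat.descFactorial_of_lt hb]
    refine Finsupp.single_apply_eq_zero.2 fun heq => ?_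
    simp only [Prod.mk.injEq] at heq
    obtain rfl : d' = d := by omega
    obtain rfl : m' = m := by omega
    have hlt : a' + b' < n := by
      by_contra hge
      obtain rfl : a' = a := by omega
      obtain rfl : b' = b := by omega
      exact hne rfl
    have hmul : r * (b' + d') ≤ r * (b + d') := Nat.mul_le_mul_left r (by omega)
    rw [ih _ hlt (by omega) (by omega) (by omega) rfl, zero_mul]
  · intro hns
    rw [Finsupp.notMem_support_iff.1 hns]
    simp

/-- An operator of order at most `k` and nonpositive `y`-degree that maps one staircase module
to another is the sum of an operator in any space `G` containing the evident operators of this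
kind, and of an operator that annihilates the source. -/
theorem exists_add_annihilating (hU : (U : Set (ℂ × ℂ)).Nonempty) {r P P' q k : ℕ} (hr : 1 ≤ r)
    (hPP : P ≤ P' + 1) {G : Submodule ℂ (Op U)} {D : Op U}
    (hD : D ∈ diffOps U {m | m.1 + m.2 ≤ k}) (hy : ∀ i j, D (mono U i j) ∈ yPolys U j)
    (hpres : ∀ f ∈ scalarModule U r P q, D f ∈ scalarModule U r P' q)
    (hA : ∀ a b s t, b ≤ t → s + t ≤ k → a + r * b + P ≤ s + r * t + P' → weylMono U a b s t ∈ G)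
    (hB : ∀ m d a b, P' < m + P → m + P ≤ a + P' → a + b + d ≤ k →
      newtonOp U r P m d a b ∈ G) :
    ∃ R ∈ G, ∃ K ∈ diffOps U Set.univ, D = R + K ∧ (∀ f ∈ scalarModule U r P q, K f = 0) ∧
      (k ≤ q → r * k ≤ P → K = 0) := by
  obtain ⟨D₁, h₁, D₂, h₂, rfl⟩ : ∃ D₁ ∈ Submodule.span ℂ {E | ∃ a b s t : ℕ, b ≤ t ∧ s + t ≤ k ∧
      a + r * b + P ≤ s + r * t + P' ∧ E = weylMono U a b s t},
      ∃ D₂ ∈ Submodule.span ℂ ((fun x : ℕ × ℕ × ℕ × ℕ => newtonOp U r P x.1 x.2.1 x.2.2.1 x.2.2.2)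
        '' {x | P' < x.1 + P ∧ x.2.2.1 + x.2.2.2 + x.2.1 ≤ k}), D₁ + D₂ = D := by
    refine Submodule.mem_sup.1 (Submodule.span_le.2 ?_ (mem_span_weylMono hD hy))
    rintro _ ⟨a, b, s, t, hbt, hst, rfl⟩
    by_cases h : a + r * b + P ≤ s + r * t + P'
    · exact Submodule.mem_sup_left (Submodule.subset_span ⟨a, b, s, t, hbt, hst, h, rfl⟩)
    · refine Submodule.mem_sup_right ?_
      obtain ⟨d, rfl⟩ := Nat.exists_eq_add_of_le hbt
      rw [mul_add] at h
      -- The excess weight `m` exceeds `P' - P ≥ -1`, so it is a natural number.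
      obtain ⟨m, rfl⟩ : ∃ m, a = m + (r * d + s) := ⟨a - (r * d + s), by omega⟩
      refine Submodule.span_mono ?_ (weylMono_mem_span_newtonOp r P m d b s)
      rintro _ ⟨a', b', hab, rfl⟩
      exact ⟨(m, d, a', b'), ⟨by simp only; omega, by simp only; omega⟩, rfl⟩
  obtain ⟨c, hc, rfl⟩ := (Finsupp.mem_span_image_iff_linearCombination ℂ).1 h₂
  have hc0 : ∀ {m d a b : ℕ}, a + P' < m + P → a + r * (b + d) ≤ P → b + d ≤ q →
      c (m, d, a, b) = 0 := by
    refine newton_coeff_eq_zero hU fun i j hij => ?_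
    have h3 := hpres _ (mono_mem_scalarModule hij)
    rw [LinearMap.add_apply] at h3
    refine (Submodule.add_mem_iff_right _ ?_).1 h3
    have h4 : Submodule.span ℂ {E | ∃ a b s t : ℕ, b ≤ t ∧ s + t ≤ k ∧
        a + r * b + P ≤ s + r * t + P' ∧ E = weylMono U a b s t} ≤
        (scalarModule U r P' q).comap (LinearMap.applyₗ (mono U i j)) := by
      refine Submodule.span_le.2 ?_
      rintro _ ⟨a, b, s, t, hbt, -, h, rfl⟩
      exact weylMono_map_scalarModule hbt h (mono_mem_scalarModule hij)
    exact h4 h₁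
  have hG : D₁ ∈ G := by
    refine Submodule.span_le.2 ?_ h₁
    rintro _ ⟨a, b, s, t, hbt, hst, h, rfl⟩
    exact hA a b s t hbt hst h
  let good : ℕ × ℕ × ℕ × ℕ → Prop := fun x => x.1 + P ≤ x.2.2.1 + P'
  classical
  have hbad : ∀ x ∈ (c.filter fun x => ¬ good x).support,
      x.2.2.1 + P' < x.1 + P ∧ x.2.2.1 + x.2.2.2 + x.2.1 ≤ k ∧
        ¬ (x.2.2.1 + r * (x.2.2.2 + x.2.1) ≤ P ∧ x.2.2.2 + x.2.1 ≤ q) := by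
    rintro ⟨m, d, a, b⟩ hx
    rw [Finsupp.support_filter, Finset.mem_filter] at hx
    have h5 : a + P' < m + P := not_le.1 hx.2
    exact ⟨h5, (hc hx.1).2, fun h6 => Finsupp.mem_support_iff.1 hx.1 (hc0 h5 h6.1 h6.2)⟩
  refine ⟨D₁ + ofNewton U r P (c.filter good), Submodule.add_mem _ hG ?_,
    ofNewton U r P (c.filter fun x => ¬ good x), ?_, ?_, ?_, ?_⟩
  · rw [ofNewton, Finsupp.linearCombination_apply]
    refine Submodule.sum_mem _ fun x hx => Submodule.smul_mem _ _ ?_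
    rw [Finsupp.support_filter, Finset.mem_filter] at hx
    exact hB _ _ _ _ (hc hx.1).1 hx.2 (hc hx.1).2
  · rw [ofNewton, Finsupp.linearCombination_apply]
    exact Submodule.sum_mem _ fun x _ => Submodule.smul_mem _ _ (newtonOp_mem_diffOps _ _ _ _ _ _)
  · rw [add_assoc, ← map_add, Finsupp.filter_add_filter_not]
    rfl
  · intro f hf
    rw [← Submodule.mem_bot ℂ]
    refine map_scalarModule_le (fun i j hij => ?_) hf
    rw [Submodule.mem_bot, ofNewton, Finsupp.linearCombination_apply, Finsupp.sum,
      LinearMap.sum_apply]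
    refine Finset.sum_eq_zero fun x hx => ?_
    obtain ⟨-, -, h6⟩ := hbad x hx
    rw [LinearMap.smul_apply, newtonOp_mono hij.1]
    by_cases ha : P - (i + r * j) < x.2.2.1
    · simp [Nat.descFactorial_of_lt ha]
    by_cases hb : j < x.2.2.2 + x.2.1
    · simp [Nat.descFactorial_of_lt hb]
    -- Nonvanishing at `(i, j)` would give `a ≤ P - (i + r j)` and `b + d ≤ j`, and so place `(a, b
    -- + d)` in the staircase.
    refine absurd ⟨?_, ?_⟩ h6
    · have hmul : r * (x.2.2.2 + x.2.1) ≤ r * j := Nat.mul_le_mul_left r (by omega)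
      have := hij.1
      simp only at this
      omega
    · have := hij.2
      simp only at this
      omega
  · intro hkq hkP
    have h7 : (c.filter fun x => ¬ good x) = 0 := by
      rw [← Finsupp.support_eq_empty, Finset.eq_empty_iff_forall_notMem]
      intro x hx
      obtain ⟨-, h8, h9⟩ := hbad x hx
      refine h9 ⟨?_, by omega⟩
      calc x.2.2.1 + r * (x.2.2.2 + x.2.1)
          ≤ r * x.2.2.1 + r * (x.2.2.2 + x.2.1) :=
            Nat.add_le_add_right (Nat.le_mul_of_pos_left _ hr) _
        _ = r * (x.2.2.1 + x.2.2.2 + x.2.1) := by ring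
        _ ≤ P := (Nat.mul_le_mul_left r h8).trans hkP
    rw [h7, map_zero]

/-! ### Polynomials in the generators -/

theorem polysLE_mono (U : Opens (ℂ × ℂ)) (r p : ℕ) : Monotone (polysLE U r p) := by
  intro m n h
  refine Submodule.span_mono ?_
  rintro _ ⟨l, hl, rfl⟩
  exact ⟨l, hl.trans h, rfl⟩

theorem gen_mem_polysLE {r p : ℕ} (g : Gen r) : gen U r p g ∈ polysLE U r p 1 :=
  Submodule.subset_span ⟨[g], le_rfl, by simp⟩

theorem one_mem_polysLE {r p : ℕ} : (1 : MatOp U) ∈ polysLE U r p 0 :=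
  Submodule.subset_span ⟨[], le_rfl, by simp⟩

theorem mul_mem_polysLE {r p m n : ℕ} {M N : MatOp U} (hM : M ∈ polysLE U r p m)
    (hN : N ∈ polysLE U r p n) : M * N ∈ polysLE U r p (m + n) := by
  have h := Submodule.mul_mem_mul hM hN
  rw [polysLE, polysLE, Submodule.span_mul_span] at h
  refine Submodule.span_mono ?_ h
  rintro _ ⟨_, ⟨l, hl, rfl⟩, _, ⟨l', hl', rfl⟩, rfl⟩
  exact ⟨l ++ l', by rw [List.length_append]; omega, by simp⟩

/-- The operators that occur as the `b`-th diagonal entry of a diagonal polynomial of degree at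
most `n` in the generators. -/
def diagPolys (U : Opens (ℂ × ℂ)) (r p : ℕ) (b : Fin 2) (n : ℕ) : Submodule ℂ (Op U) where
  carrier := {D | ∃ M ∈ polysLE U r p n, M 0 1 = 0 ∧ M 1 0 = 0 ∧ M b b = D}
  add_mem' := by
    rintro _ _ ⟨M, hM, h01, h10, rfl⟩ ⟨N, hN, h01', h10', rfl⟩
    exact ⟨M + N, Submodule.add_mem _ hM hN, by simp [h01, h01'], by simp [h10, h10'], rfl⟩
  zero_mem' := ⟨0, Submodule.zero_mem _, rfl, rfl, rfl⟩
  smul_mem' := by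
    rintro c _ ⟨M, hM, h01, h10, rfl⟩
    exact ⟨c • M, Submodule.smul_mem _ _ hM, by simp [h01], by simp [h10], rfl⟩

theorem diagPolys_mono (U : Opens (ℂ × ℂ)) (r p : ℕ) (b : Fin 2) :
    Monotone (diagPolys U r p b) := by
  rintro m n h _ ⟨M, hM, h'⟩
  exact ⟨M, polysLE_mono U r p h hM, h'⟩

theorem gen_mul_mem_diagPolys {r p n : ℕ} {b : Fin 2} (g : Gen r) (h01 : gen U r p g 0 1 = 0)
    (h10 : gen U r p g 1 0 = 0) {D : Op U} (hD : D ∈ diagPolys U r p b n) :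
    gen U r p g b b * D ∈ diagPolys U r p b (n + 1) := by
  obtain ⟨M, hM, h01', h10', rfl⟩ := hD
  refine ⟨gen U r p g * M, ?_, ?_, ?_, ?_⟩
  · rw [add_comm]
    exact mul_mem_polysLE (gen_mem_polysLE g) hM
  · simp [Matrix.mul_apply, h01, h01']
  · simp [Matrix.mul_apply, h10, h10']
  · rw [Matrix.mul_apply, Fin.sum_univ_two]
    fin_cases b
    · simp [h01]
    · simp [h10]

theorem cast_width_zero {p : ℕ} (hp : 1 ≤ p) : ((width p 0 : ℕ) : ℂ) = p - 1 := by
  simp [width, Nat.cast_sub hp]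

theorem isGenFiltration_diagPolys {r p : ℕ} (hp : 1 ≤ p) (b : Fin 2) :
    IsGenFiltration r (width p b : ℂ) (diagPolys U r p b) where
  one_mem := ⟨1, one_mem_polysLE, by simp, by simp, by simp⟩
  mono := diagPolys_mono U r p b
  dx_mul {n D} hD := by
    have h := gen_mul_mem_diagPolys (Gen.T1 : Gen r) (by simp [gen]) (by simp [gen]) hD
    fin_cases b <;> exact h
  X_dx_mul {n D} hD := by
    have h := gen_mul_mem_diagPolys (Gen.T3 : Gen r) (by simp [gen]) (by simp [gen]) hD
    have h1 : gen U r p Gen.T3 b b = J3 (width p b : ℂ) := by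
      fin_cases b
      · exact congrArg J3 (cast_width_zero hp).symm
      · rfl
    -- The constant in `J3` is removed by a multiple of `D`, which already lies in the smaller
    -- filtration step.
    rw [h1, J3, Op.sub_eq, smul_smul, add_mul, smul_mul_assoc, one_mul] at h
    rw [Op.eq_add_neg_smul (D := X * dx * D) rfl]
    exact Submodule.add_mem _ h (Submodule.smul_mem _ _ (diagPolys_mono U r p b n.le_succ hD))
  Y_dy_mul {n D} hD := by
    have h := gen_mul_mem_diagPolys (Gen.T4 : Gen r) (by simp [gen]) (by simp [gen]) hD
    fin_cases b <;> exact h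
  X_pow_dy_mul {n D i} hi hD := by
    have h := gen_mul_mem_diagPolys (Gen.T5 ⟨i, Nat.lt_succ_of_le hi⟩ : Gen r) (by simp [gen])
      (by simp [gen]) hD
    fin_cases b <;> exact h
  J2_mul {n D} hD := by
    have h := gen_mul_mem_diagPolys (Gen.T2 : Gen r) (by simp [gen]) (by simp [gen]) hD
    have h1 : gen U r p Gen.T2 b b = J2 r (width p b : ℂ) := by
      fin_cases b
      · exact congrArg (J2 r) (cast_width_zero hp).symm
      · rfl
    rwa [h1] at h

/-- The operators that, placed in the entry `(a, b)`, give a polynomial of degree at most `n` in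
the generators. -/
def blockPolys (U : Opens (ℂ × ℂ)) (r p : ℕ) (a b : Fin 2) (n : ℕ) : Submodule ℂ (Op U) :=
  (polysLE U r p n).comap (Matrix.singleLinearMap ℂ a b)

theorem blockPolys_mono (U : Opens (ℂ × ℂ)) (r p : ℕ) (a b : Fin 2) :
    Monotone (blockPolys U r p a b) :=
  fun _ _ h => Submodule.comap_mono (polysLE_mono U r p h)

/-- A matrix supported in entry `(a, b)` sees only the `b`-th diagonal entry of a diagonal factor on
its right, so the other diagonal entry of `M` is irrelevant. -/
theorem mul_mem_blockPolys {r p m n : ℕ} {a b : Fin 2} {Q D : Op U}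
    (hQ : Q ∈ blockPolys U r p a b m) (hD : D ∈ diagPolys U r p b n) :
    Q * D ∈ blockPolys U r p a b (m + n) := by
  obtain ⟨M, hM, h01, h10, rfl⟩ := hD
  have h := mul_mem_polysLE hQ hM
  have h1 : Matrix.single a b Q * M = Matrix.single a b (Q * M b b) := by
    fin_cases a <;> fin_cases b <;> ext1 i j <;> fin_cases i <;> fin_cases j <;>
      simp [Matrix.mul_apply, Fin.sum_univ_two, h01, h10]
  change Matrix.single a b (Q * M b b) ∈ polysLE U r p (m + n)
  rw [← h1]
  exact h

/-- The idempotents are `2 J - p` and `p + 1 - 2 J`. -/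
theorem one_mem_blockPolys_diag {r p : ℕ} (a : Fin 2) : 1 ∈ blockPolys U r p a a 1 := by
  have h1 : (1 : MatOp U) ∈ polysLE U r p 1 := polysLE_mono U r p zero_le_one one_mem_polysLE
  have hJ : gen U r p Gen.J ∈ polysLE U r p 1 := gen_mem_polysLE _
  change Matrix.single a a (1 : Op U) ∈ polysLE U r p 1
  fin_cases a
  · have h : Matrix.single (0 : Fin 2) (0 : Fin 2) (1 : Op U) =
        (2 : ℂ) • gen U r p Gen.J + (-p : ℂ) • (1 : MatOp U) := by
      ext1 i j
      fin_cases i <;> fin_cases j <;> simp [gen] <;> module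
    exact h ▸ Submodule.add_mem _ (Submodule.smul_mem _ _ hJ) (Submodule.smul_mem _ _ h1)
  · have h : Matrix.single (1 : Fin 2) (1 : Fin 2) (1 : Op U) =
        (-2 : ℂ) • gen U r p Gen.J + (p + 1 : ℂ) • (1 : MatOp U) := by
      ext1 i j
      fin_cases i <;> fin_cases j <;> simp [gen] <;> module
    exact h ▸ Submodule.add_mem _ (Submodule.smul_mem _ _ hJ) (Submodule.smul_mem _ _ h1)

theorem mem_blockPolys_of_gen_eq {r p : ℕ} {a b : Fin 2} {Q : Op U} (g : Gen r)
    (h : gen U r p g = Matrix.single a b Q) : Q ∈ blockPolys U r p a b 1 := by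
  change Matrix.single a b Q ∈ polysLE U r p 1
  exact h ▸ gen_mem_polysLE g

theorem one_mem_blockPolys_minus {r p : ℕ} : 1 ∈ blockPolys U r p 1 0 1 := by
  refine mem_blockPolys_of_gen_eq Gen.Qm0 ?_
  ext1 i j
  fin_cases i <;> fin_cases j <;> simp [gen]

theorem X_mem_blockPolys_minus {r p : ℕ} : X ∈ blockPolys U r p 1 0 1 := by
  refine mem_blockPolys_of_gen_eq Gen.Qm1 ?_
  ext1 i j
  fin_cases i <;> fin_cases j <;> simp [gen]

theorem dx_mem_blockPolys_plus {r p : ℕ} : dx ∈ blockPolys U r p 0 1 1 := by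
  refine mem_blockPolys_of_gen_eq Gen.Qp1 ?_
  ext1 i j
  fin_cases i <;> fin_cases j <;> simp [gen]

theorem X_pow_dy_mem_blockPolys_plus {r p i : ℕ} (hi : i < r) :
    X ^ i * dy ∈ blockPolys U r p 0 1 1 := by
  refine mem_blockPolys_of_gen_eq (Gen.Qp2 ⟨i, hi⟩) ?_
  ext1 i j
  fin_cases i <;> fin_cases j <;> simp [gen]

theorem coweight_mem_blockPolys_plus {r p : ℕ} : coweight U r p ∈ blockPolys U r p 0 1 1 := by
  have h : X * dx + (r : ℂ) • (Y * dy) - (p : ℂ) • 1 ∈ blockPolys U r p 0 1 1 := by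
    refine mem_blockPolys_of_gen_eq Gen.Qp0 ?_
    ext1 i j
    fin_cases i <;> fin_cases j <;> simp [gen]
  have h1 : coweight U r p =
      (-1 : ℂ) • (X * dx + (r : ℂ) • (Y * dy) - (p : ℂ) • 1) := by
    rw [coweight, Op.sub_eq]
    module
  rw [h1]
  exact Submodule.smul_mem _ _ h

/-! ### Membership of the basis operators -/

theorem weylMono_mem_blockPolys_diag {r p : ℕ} (hp : 1 ≤ p) (c : Fin 2) {a b s t k : ℕ}
    (hbt : b ≤ t) (hst : s + t ≤ k) (h : a + r * b ≤ s + r * t) :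
    weylMono U a b s t ∈ blockPolys U r p c c (k + 1) := by
  have h1 := mul_mem_blockPolys (one_mem_blockPolys_diag c)
    ((isGenFiltration_diagPolys (U := U) hp c).weylMono_mem hbt h)
  rw [one_mul] at h1
  exact blockPolys_mono U r p c c (by omega) h1

theorem newtonOp_mem_diagPolys {r p : ℕ} (hp : 1 ≤ p) (c : Fin 2) {m d a b : ℕ} (hma : m ≤ a) :
    newtonOp U r (width p c) m d a b ∈ diagPolys U r p c (a + b + d) := by
  have hA := isGenFiltration_diagPolys (U := U) (r := r) hp c
  have h := hA.X_pow_mul_falling_mul hma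
    (hA.weylMono_mem (a := r * d) (b := b) (s := 0) (t := b + d)
      (by omega) (by rw [mul_add]; omega))
  rwa [mul_assoc, zero_add, ← add_assoc] at h

theorem newtonOp_mem_blockPolys_diag {r p : ℕ} (hp : 1 ≤ p) (c : Fin 2) {m d a b k : ℕ}
    (hma : m ≤ a) (hk : a + b + d ≤ k) :
    newtonOp U r (width p c) m d a b ∈ blockPolys U r p c c (k + 1) := by
  have h1 := mul_mem_blockPolys (one_mem_blockPolys_diag c)
    (newtonOp_mem_diagPolys (U := U) (r := r) (d := d) (b := b) hp c hma)
  rw [one_mul] at h1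
  exact blockPolys_mono U r p c c (by omega) h1

/-- Weight 1 is allowed here: `Q^-_1` takes off one `x` if there is one, and otherwise `b ≤ t`
already forces nonpositive weight and `Q^-_0` suffices. -/
theorem weylMono_mem_blockPolys_minus {r p : ℕ} (hp : 1 ≤ p) {a b s t k : ℕ}
    (hbt : b ≤ t) (hst : s + t ≤ k) (h : a + r * b ≤ s + r * t + 1) :
    weylMono U a b s t ∈ blockPolys U r p 1 0 (k + 1) := by
  have hA := isGenFiltration_diagPolys (U := U) (r := r) hp 0
  rcases a with _ | a
  · have h1 := mul_mem_blockPolys one_mem_blockPolys_minus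
      (hA.weylMono_mem (a := 0) (s := s) hbt
        (by have := Nat.mul_le_mul_left r hbt; omega))
    rw [one_mul] at h1
    exact blockPolys_mono U r p 1 0 (by omega) h1
  · have h1 := mul_mem_blockPolys X_mem_blockPolys_minus
      (hA.weylMono_mem (a := a) (s := s) hbt (by omega))
    rw [← pow_one X, X_pow_mul_weylMono, add_comm 1 a] at h1
    exact blockPolys_mono U r p 1 0 (by omega) h1

theorem newtonOp_mem_blockPolys_minus {r p : ℕ} (hp : 1 ≤ p) {m d a b k : ℕ} (hm : 1 ≤ m)
    (hma : m ≤ a + 1) (hk : a + b + d ≤ k) :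
    newtonOp U r (width p 0) m d a b ∈ blockPolys U r p 1 0 (k + 1) := by
  obtain ⟨m, rfl⟩ := Nat.exists_eq_add_of_le hm
  have h1 := mul_mem_blockPolys X_mem_blockPolys_minus
    (newtonOp_mem_diagPolys (U := U) (r := r) (m := m) (d := d) (a := a) (b := b) hp 0 (by omega))
  rw [newtonOp, ← mul_assoc, ← pow_succ', add_comm m 1] at h1
  exact blockPolys_mono U r p 1 0 (by omega) h1

/-- The weight is at most -1, which the leftmost factor `∂x` or `x^i ∂y` with `i < r` provides
through `Q^+`. The rest has nonpositive weight and is diagonal. -/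
theorem weylMono_mem_blockPolys_plus {r p : ℕ} (hp : 1 ≤ p) (hr : 1 ≤ r) {a b s t : ℕ}
    (hbt : b ≤ t) (h : a + r * b + 1 ≤ s + r * t) :
    weylMono U a b s t ∈ blockPolys U r p 0 1 (s + t) := by
  have hA := isGenFiltration_diagPolys (U := U) (r := r) hp 1
  induction hn : s + t generalizing a b s t with
  | zero =>
    obtain ⟨rfl, rfl⟩ : s = 0 ∧ t = 0 := by omega
    simp at h
  | succ n ih =>
    have hle : blockPolys U r p 0 1 n ≤ blockPolys U r p 0 1 (n + 1) :=
      blockPolys_mono U r p 0 1 n.le_succ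
    rcases hbt.lt_or_eq with hlt | rfl
    · obtain ⟨t, rfl⟩ : ∃ t', t = t' + 1 := ⟨t - 1, by omega⟩
      have hmul : r * b ≤ r * t := Nat.mul_le_mul_left r (by omega)
      rw [mul_add_one] at h
      have h1 := X_pow_dy_mul_weylMono (U := U) (min a (r - 1)) (a - min a (r - 1)) b s t
      rw [Nat.add_sub_cancel' (min_le_left a (r - 1))] at h1
      rw [Op.eq_add_neg_smul h1]
      have h2 := mul_mem_blockPolys (X_pow_dy_mem_blockPolys_plus (i := min a (r - 1)) (by omega))
        (hA.weylMono_mem (a := a - min a (r - 1)) (b := b) (s := s) (t := t) (by omega) (by omega))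
      refine Submodule.add_mem _ (blockPolys_mono U r p 0 1 (by omega) h2) ?_
      rcases b with _ | b
      · simp
      · refine Submodule.smul_mem _ _ (hle (ih (by omega) ?_ (by omega)))
        rw [Nat.add_sub_cancel]
        rw [mul_add_one] at h
        omega
    · obtain ⟨s, rfl⟩ : ∃ s', s = s' + 1 := ⟨s - 1, by omega⟩
      rw [Op.eq_add_neg_smul (dx_mul_weylMono (U := U) a b s b)]
      have h2 := mul_mem_blockPolys dx_mem_blockPolys_plus
        (hA.weylMono_mem (a := a) (b := b) (s := s) (t := b) le_rfl (by omega))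
      refine Submodule.add_mem _ (blockPolys_mono U r p 0 1 (by omega) h2) ?_
      rcases a with _ | a
      · simp
      · exact Submodule.smul_mem _ _ (hle (ih le_rfl (by omega) (by omega)))

theorem X_pow_mul_falling_mul_mem_blockPolys_plus {r p : ℕ} (hp : 1 ≤ p) {m a n : ℕ} {D : Op U}
    (hma : m + 1 ≤ a) (hD : D ∈ diagPolys U r p 1 n) :
    X ^ m * falling (coweight U r p) a * D ∈ blockPolys U r p 0 1 (a + n) := by
  have hA : IsGenFiltration r (p : ℂ) (diagPolys U r p 1) := isGenFiltration_diagPolys hp 1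
  induction a, hma using Nat.le_induction generalizing n D with
  | base =>
    have h1 : Commute (coweight U r p + (-m : ℂ) • 1) (falling (coweight U r p) m) :=
      commute_falling ((Commute.refl _).add_left ((Commute.one_left _).smul_left _)) m
    -- Bringing `V - m` to the front past `x^m` turns it into `V`, which is `-Q^+_0`.
    rw [falling, ← h1.eq, ← mul_assoc, ← coweight_mul_X_pow, mul_assoc, mul_assoc,
      ← mul_assoc (X ^ m)]
    have h2 := mul_mem_blockPolys coweight_mem_blockPolys_plus
      (hA.X_pow_mul_falling_mul (e := m) le_rfl hD)
    exact blockPolys_mono U r p 0 1 (by omega) h2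
  | succ a _ ih =>
    rw [falling, ← mul_assoc, mul_assoc]
    exact blockPolys_mono U r p 0 1 (by omega) (ih (hA.coweight_add_mul (-a : ℂ) hD))

theorem newtonOp_mem_blockPolys_plus {r p : ℕ} (hp : 1 ≤ p) {m d a b k : ℕ}
    (hma : m + 1 ≤ a) (hk : a + b + d ≤ k) :
    newtonOp U r (width p 1) m d a b ∈ blockPolys U r p 0 1 (k + 1) := by
  have hA := isGenFiltration_diagPolys (U := U) (r := r) hp 1
  have h := X_pow_mul_falling_mul_mem_blockPolys_plus hp hma
    (hA.weylMono_mem (a := r * d) (b := b) (s := 0) (t := b + d)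
      (by omega) (by rw [mul_add]; omega))
  rw [mul_assoc] at h
  exact blockPolys_mono U r p 0 1 (by omega) h

/-! ### Matrix operators -/

theorem entry_map_scalarModule {r p q : ℕ} {T : MatOp U} (hT : T ∈ preserving U r p q)
    (a b : Fin 2) {f : SmoothFn U} (hf : f ∈ scalarModule U r (width p b) q) :
    T a b f ∈ scalarModule U r (width p a) q := by
  have h := hT.2 (Pi.single b f) (fun c => by
    by_cases hc : c = b
    · subst hc
      simpa using hf
    · simp [hc]) a
  have h1 : act T (Pi.single b f) a = T a b f := by
    rw [act, Finset.sum_eq_single b]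
    · simp
    · intro c _ hc
      simp [hc]
    · simp
  rwa [h1] at h

theorem exists_block_decomposition (hU : (U : Set (ℂ × ℂ)).Nonempty) {r p q k : ℕ} (hr : 2 ≤ r)
    (hp : 1 ≤ p) {T : MatOp U} (hT : T ∈ preserving U r p q) (hy : YDegNonpos T)
    (hk : T ∈ orderLE U k) (a b : Fin 2) :
    ∃ R ∈ blockPolys U r p a b (k + 1), ∃ K ∈ diffOps U Set.univ, T a b = R + K ∧
      (∀ f ∈ scalarModule U r (width p b) q, K f = 0) ∧
      (k ≤ q → r * k ≤ width p b → K = 0) := by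
  have hw0 : width p 0 = p - 1 := rfl
  have hw1 : width p 1 = p := rfl
  refine exists_add_annihilating (P' := width p a) hU (by omega) ?_ (hk a b) (hy a b)
    (fun f hf => entry_map_scalarModule hT a b hf) ?_ ?_
  · revert a b
    simp only [Fin.forall_fin_two, hw0, hw1]
    omega
  · intro i j s t hjt hst h
    revert a b
    simp only [Fin.forall_fin_two, hw0, hw1]
    refine ⟨⟨fun h => ?_, fun h => ?_⟩, fun h => ?_, fun h => ?_⟩
    · exact weylMono_mem_blockPolys_diag hp 0 hjt hst (by omega)
    · exact blockPolys_mono U r p 0 1 (by omega)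
        (weylMono_mem_blockPolys_plus hp (by omega) hjt (by omega))
    · exact weylMono_mem_blockPolys_minus hp hjt hst (by omega)
    · exact weylMono_mem_blockPolys_diag hp 1 hjt hst (by omega)
  · intro m d i j hm hmi hk
    revert a b
    rw [Fin.forall_fin_two, Fin.forall_fin_two, Fin.forall_fin_two]
    refine ⟨⟨fun _ h => ?_, fun _ h => ?_⟩, fun h' h => ?_, fun _ h => ?_⟩
    · exact newtonOp_mem_blockPolys_diag hp 0 (by omega) hk
    · exact newtonOp_mem_blockPolys_plus hp (by omega) hk
    · exact newtonOp_mem_blockPolys_minus hp (by omega) (by omega) hk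
    · exact newtonOp_mem_blockPolys_diag hp 1 (by omega) hk

/-- `K` annihilates the module entrywise, so `P` and `T` act alike on it. -/
theorem isProjection_of_add {r p q : ℕ} {T P K : MatOp U} (hT : T ∈ complement U r p q)
    (hK : K ∈ matDiffOps U) (hTPK : ∀ a b, T a b = P a b + K a b)
    (h0 : ∀ a b, ∀ f ∈ scalarModule U r (width p b) q, K a b f = 0) : IsProjection r p q P T := by
  have hP : ∀ a b, P a b = T a b + (-1 : ℂ) • K a b :=
    fun a b => Op.eq_add_neg_smul (by rw [one_smul, hTPK])
  have hPT : ∀ a b, (P - T) a b = (-1 : ℂ) • K a b := by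
    intro a b
    rw [Matrix.sub_apply, hTPK, Op.sub_eq]
    module
  have hact : ∀ v ∈ stairModule U r p q, act P v = act T v := by
    intro v hv
    refine funext fun a => Finset.sum_congr rfl fun b _ => ?_
    rw [hTPK, LinearMap.add_apply, h0 a b _ (hv b), add_zero]
  have hact0 : ∀ v ∈ stairModule U r p q, act (P - T) v = 0 := by
    intro v hv
    refine funext fun a => Finset.sum_eq_zero fun b _ => ?_
    rw [hPT, LinearMap.smul_apply, h0 a b _ (hv b), smul_zero]
  refine ⟨⟨fun a b => ?_, fun v hv => ?_⟩, hT, ⟨fun a b => ?_, fun v hv => ?_⟩, hact0⟩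
  · rw [hP]
    exact Submodule.add_mem _ (hT.1.1 a b) (Submodule.smul_mem _ _ (hK a b))
  · rw [hact v hv]
    exact hT.1.2 v hv
  · rw [hPT]
    exact Submodule.smul_mem _ _ (hK a b)
  · rw [hact0 v hv]
    exact fun b => Submodule.zero_mem _

theorem mem_polysLE_of_blocks {r p n : ℕ} {P : MatOp U}
    (h : ∀ a b, P a b ∈ blockPolys U r p a b n) : P ∈ polysLE U r p n := by
  rw [Matrix.matrix_eq_sum_single P]
  exact Submodule.sum_mem _ fun a _ => Submodule.sum_mem _ fun b _ => h a b

theorem subsingleton_op_of_eq_empty (hU : ¬ (U : Set (ℂ × ℂ)).Nonempty) :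
    Subsingleton (Op U) :=
  ⟨fun _ _ => LinearMap.ext fun _ => SmoothFn.ext_on fun z hz => absurd ⟨z, hz⟩ hU⟩

end Staircase

end

theorem mainTheorem8 (U : TopologicalSpace.Opens (ℂ × ℂ)) (r p q k : ℕ)
    (hr : 2 ≤ r) (hp : 1 ≤ p) (T : Staircase.MatOp U)
    (hT : T ∈ Staircase.complementDown U r p q) (hk : T ∈ Staircase.orderLE U k) :
    (k ≤ q → r * k ≤ p - 1 → T ∈ Staircase.polysLE U r p (k + 1)) ∧
      (∃ P ∈ Staircase.polysLE U r p (k + 1), Staircase.IsProjection r p q P T) := by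
  by_cases hU : (U : Set (ℂ × ℂ)).Nonempty
  · choose R hR K hK hTRK h0 hK0 using
      Staircase.exists_block_decomposition hU hr hp hT.1.1 hT.2 hk
    refine ⟨fun hkq hkp => Staircase.mem_polysLE_of_blocks fun a b => ?_, Matrix.of R,
      Staircase.mem_polysLE_of_blocks hR, Staircase.isProjection_of_add (K := Matrix.of K) hT.1 hK
        hTRK h0⟩
    have hw : p - 1 ≤ Staircase.width p b := by
      fin_cases b
      · exact le_rfl
      · exact Nat.sub_le p 1
    rw [hTRK, hK0 a b hkq (hkp.trans hw), add_zero]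
    exact hR a b
  -- Linear independence of monomials fails on the empty set, but there every operator is zero.
  · have := Staircase.subsingleton_op_of_eq_empty hU
    have hT0 : T = 0 := Matrix.ext fun _ _ => Subsingleton.elim _ _
    have hT' : T ∈ Staircase.polysLE U r p (k + 1) := hT0 ▸ Submodule.zero_mem _
    exact ⟨fun _ _ => hT', T, hT', Staircase.isProjection_of_add (K := 0) hT.1
      (fun _ _ => Submodule.zero_mem _) (fun _ _ => Subsingleton.elim _ _) fun _ _ _ _ => rfl⟩
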